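/- Let $K\ge 1$ and $0\le \ell<u\le K$ be integers, and write $[K]=\{1,\dots,K\}$. For each $k\in[K]$ let $f_0^k,f_1^k$ be probability densities with respect to a $\sigma$-finite measure $\mu^k$ on a measurable space, such that the laws $f_0^k\,d\mu^k$ and $f_1^k\,d\mu^k$ are mutually absolutely continuous. Suppose that $$D_0^k=\int \log\Big(\frac{f_0^k}{f_1^k}\Big) f_0^k\,d\mu^k,\qquad D_1^k=\int \log\Big(\frac{f_1^k}{f_0^k}\Big) f_1^k\,d\mu^k$$ are positive and finite and that $\int \big(\log (f_0^k/f_1^k)\big)^2 f_i^k\,d\mu^k<\infty$ for $i=0,1$. For $\mathcal A\subset[K]$ let $\mathsf P_{\mathcal A}$ be the law, on the canonical space, of $K$ independent streams $(X_n^k)_{n\ge1}$, where stream $k$ is i.i.d. with density $f_1^k$ if $k\in\mathcal A$ and $f_0^k$ if $k\notin\mathcal A$. Let $\mathcal F_n=\sigma(X_i^k: i\le n,\ k\in[K])$. A sequential test is a pair $(T,d)$ of an $(\mathcal F_n)$-stopping time $T\in\{1,2,\dots,\infty\}$ and an $\mathcal F_T$-measurable random set $d\subset[K]$. Let $\mathcal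 P_{\ell,u}=\{\mathcal A\subset[K]:\ell\le|\mathcal A|\le u\}$, and let $\Delta_{\alpha,\beta}(\mathcal P_{\ell,u})$ be the set of sequential tests with $\mathsf P_{\mathcal A}(d\setminus\mathcal A\ne\emptyset)\le\alpha$ and $\mathsf P_{\mathcal A}(\mathcal A\setminus d\neq\emptyset)\le\beta$ for every $\mathcal A\in\mathcal P_{\ell,u}$. Let $\lambda^k(n)=\sum_{i=1}^n\log\big(f_1^k(X_i^k)/f_0^k(X_i^k)\big)$, let $\lambda^{(1)}(n)\ge\dots\ge\lambda^{(K)}(n)$ be the ordered values, with $\lambda^{(0)}=-\infty$ and $\lambda^{(K+1)}=\infty$, and let $p(n)=|\{k:\lambda^k(n)>0\}|$. For $\alpha,\beta\in(0,1)$ put $$a=|\log\beta|+\log K,\quad b=|\log\alpha|+\log K,\quad c=|\log\alpha|+\log((K-\ell)K),\quad d=|\log\beta|+\log(uK).$$ The gap-intersection rule $(T_{GI},d_{GI})$ stops at $T_{GI}=\min\{\tau_1,\tau_2,\tau_3\}$, where $$\tau_1=\inf\{n\ge1:\lambda^{(\ell+1)}(n)\le -a,\ \lambda^{(\ell)}(n)-\lambda^{(\ell+1)}(n)\ge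 c\},$$ $$\tau_2=\inf\{n\ge1:\ell\le p(n)\le u,\ \lambda^k(n)\notin(-a,b)\ \text{for every } k\in[K]\},$$ $$\tau_3=\inf\{n\ge1:\lambda^{(u)}(n)\ge b,\ \lambda^{(u)}(n)-\lambda^{(u+1)}(n)\ge d\},$$ and $d_{GI}$ is the set of the $p'=(p(T_{GI})\vee\ell)\wedge u$ streams with the largest log-likelihood ratios at time $T_{GI}$ (ties broken by the stream index; a fixed set if $T_{GI}=\infty$). Then $(T_{GI},d_{GI})\in\Delta_{\alpha,\beta}(\mathcal P_{\ell,u})$ for all $\alpha,\beta\in(0,1)$, and the rule is asymptotically optimal: for every $\mathcal A\in\mathcal P_{\ell,u}$, as $\alpha,\beta\to0$ at arbitrary rates, $$\mathsf E_{\mathcal A}[T_{GI}]\ \sim\ \inf_{(T,d)\in\Delta_{\alpha,\beta}(\mathcal P_{\ell,u})}\mathsf E_{\mathcal A}[T]\ \sim\ \begin{cases}\max\Big\{\dfrac{|\log\beta|}{\eta_0^{\mathcal A}},\dfrac{|\log\alpha|}{\eta_0^{\mathcal A}+\eta_1^{\mathcal A}}\Big\}&\text{if }|\mathcal A|=\ell,\\[2ex]\max\Big\{\dfrac{|\log\beta|}{\eta_0^{\mathcal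 A}},\dfrac{|\log\alpha|}{\eta_1^{\mathcal A}}\Big\}&\text{if }\ell<|\mathcal A|<u,\\[2ex]\max\Big\{\dfrac{|\log\alpha|}{\eta_1^{\mathcal A}},\dfrac{|\log\beta|}{\eta_0^{\mathcal A}+\eta_1^{\mathcal A}}\Big\}&\text{if }|\mathcal A|=u,\end{cases}$$ where $\eta_1^{\mathcal A}=\min_{k\in\mathcal A}D_1^k$ and $\eta_0^{\mathcal A}=\min_{k\notin\mathcal A}D_0^k$, a minimum over the empty set being $\infty$ (and $x/\infty=0$), and $x\sim y$ means $x/y\to1$. -/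

import Mathlib

open MeasureTheory ProbabilityTheory Filter Topology
open scoped ENNReal

noncomputable section

namespace SeqMultTest

/-- One stream of i.i.d. observations with values in `S`: a `σ`-finite dominating measure `μ` and the
densities `f₀`, `f₁` of one observation under the null and the alternative. The two laws of an
observation are mutually absolutely continuous. -/
structure Stream (S : Type*) [MeasurableSpace S] where
  μ : Measure S
  sigmaFinite : SigmaFinite μ
  f₀ : S → ℝ
  f₁ : S → ℝ
  measurable_f₀ : Measurable f₀
  measurable_f₁ : Measurable f₁
  nonneg_f₀ : ∀ x, 0 ≤ f₀ x
  nonneg_f₁ : ∀ x, 0 ≤ f₁ x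
  lintegral_f₀ : ∫⁻ x, ENNReal.ofReal (f₀ x) ∂μ = 1
  lintegral_f₁ : ∫⁻ x, ENNReal.ofReal (f₁ x) ∂μ = 1
  ac₀₁ : μ.withDensity (fun x => ENNReal.ofReal (f₀ x)) ≪
    μ.withDensity (fun x => ENNReal.ofReal (f₁ x))
  ac₁₀ : μ.withDensity (fun x => ENNReal.ofReal (f₁ x)) ≪
    μ.withDensity (fun x => ENNReal.ofReal (f₀ x))

namespace Stream

variable {S : Type*} [MeasurableSpace S] (M : Stream S)

/-- Law of a single observation under the null. -/
def law₀ : Measure S := M.μ.withDensity (fun x => ENNReal.ofReal (M.f₀ x))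

/-- Law of a single observation under the alternative. -/
def law₁ : Measure S := M.μ.withDensity (fun x => ENNReal.ofReal (M.f₁ x))

/-- Law of the whole i.i.d. sequence under the null. -/
def P₀ : Measure (ℕ → S) := Measure.infinitePi (fun _ : ℕ => M.law₀)

/-- Law of the whole i.i.d. sequence under the alternative. -/
def P₁ : Measure (ℕ → S) := Measure.infinitePi (fun _ : ℕ => M.law₁)

/-- Kullback--Leibler number `D₀ = ∫ log (f₀ / f₁) f₀ dμ`. -/
def D₀ : ℝ := ∫ x, Real.log (M.f₀ x / M.f₁ x) * M.f₀ x ∂M.μ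

/-- Kullback--Leibler number `D₁ = ∫ log (f₁ / f₀) f₁ dμ`. -/
def D₁ : ℝ := ∫ x, Real.log (M.f₁ x / M.f₀ x) * M.f₁ x ∂M.μ

/-- `D₀` and `D₁` are positive and finite. -/
def KLPosFinite : Prop :=
  Integrable (fun x => Real.log (M.f₀ x / M.f₁ x) * M.f₀ x) M.μ ∧
  Integrable (fun x => Real.log (M.f₁ x / M.f₀ x) * M.f₁ x) M.μ ∧
  0 < M.D₀ ∧ 0 < M.D₁

/-- The log-likelihood ratio has finite second moments under both hypotheses. -/
def SecondMoments : Prop :=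
  Integrable (fun x => Real.log (M.f₀ x / M.f₁ x) ^ 2 * M.f₀ x) M.μ ∧
  Integrable (fun x => Real.log (M.f₀ x / M.f₁ x) ^ 2 * M.f₁ x) M.μ

end Stream

variable {K : ℕ} {S : Fin K → Type*} [∀ k, MeasurableSpace (S k)]

/-- The canonical space of the data of all streams. The observation `X_n^k`, `n = 1, 2, …`, is the
coordinate `ω k (n - 1)`, i.e. `ω k i` is the `(i + 1)`-st observation of stream `k`. -/
abbrev Path (S : Fin K → Type*) : Type _ := (k : Fin K) → ℕ → S k

/-- The law `P_A` of the data when `A` is the set of streams with signal. -/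
def P (M : ∀ k, Stream (S k)) (A : Finset (Fin K)) : Measure (Path S) :=
  Measure.pi (fun k => if k ∈ A then (M k).P₁ else (M k).P₀)

/-- `ℱ n` is generated by the first `n` observations of all streams. -/
def ℱ (S : Fin K → Type*) [∀ k, MeasurableSpace (S k)] :
    Filtration ℕ (inferInstance : MeasurableSpace (Path S)) where
  seq n := ⨆ (k : Fin K) (i : ℕ) (_ : i < n),
    MeasurableSpace.comap (fun ω : Path S => ω k i) inferInstance
  mono' := by
    intro m n hmn
    refine iSup_le fun k => iSup_le fun i => iSup_le fun hi => ?_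
    exact le_iSup_of_le k (le_iSup_of_le i (le_iSup_of_le (lt_of_lt_of_le hi hmn) le_rfl))
  le' := by
    intro n
    refine iSup_le fun k => iSup_le fun i => iSup_le fun _ => ?_
    exact Measurable.comap_le ((measurable_pi_apply i).comp (measurable_pi_apply k))

/-- `(T, d)` is a sequential test: `T` is an `ℱ`-stopping time with values in `{1, 2, …, ∞}` and the
decision `d` (the set of streams declared to have signal) is `ℱ_T`-measurable. -/
def IsSequentialTest (T : Path S → ℕ∞) (d : Path S → Finset (Fin K)) : Prop :=
  (∀ ω, 1 ≤ T ω) ∧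
  ∃ hT : IsStoppingTime (ℱ S) T, ∀ k, MeasurableSet[hT.measurableSpace] {ω | k ∈ d ω}

/-- The class `Δ_{α,β}(𝒞)`: sequential tests whose familywise type I and type II error
probabilities are at most `α` and `β` under every `A ∈ 𝒞`. -/
def Δ (M : ∀ k, Stream (S k)) (𝒞 : Set (Finset (Fin K))) (α β : ℝ) :
    Set ((Path S → ℕ∞) × (Path S → Finset (Fin K))) :=
  {t | IsSequentialTest t.1 t.2 ∧ ∀ A ∈ 𝒞,
    P M A {ω | (t.2 ω \ A).Nonempty} ≤ ENNReal.ofReal α ∧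
    P M A {ω | (A \ t.2 ω).Nonempty} ≤ ENNReal.ofReal β}

/-- The class `P_{ℓ,u}` of sets with at least `ℓ` and at most `u` elements. -/
def sizeClass (K ℓ u : ℕ) : Set (Finset (Fin K)) := {A | ℓ ≤ A.card ∧ A.card ≤ u}

/-- Expected sample size `E_A[T]`, with value `∞` allowed. -/
def expectedTime (M : ∀ k, Stream (S k)) (A : Finset (Fin K)) (T : Path S → ℕ∞) : ℝ≥0∞ :=
  ∫⁻ ω, (T ω : ℝ≥0∞) ∂(P M A)

/-- The optimal expected sample size: infimum of `E_A[T]` over `(T, d) ∈ Δ_{α,β}(𝒞)`. -/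
def optimalTime (M : ∀ k, Stream (S k)) (𝒞 : Set (Finset (Fin K))) (A : Finset (Fin K))
    (α β : ℝ) : ℝ≥0∞ :=
  ⨅ t ∈ Δ M 𝒞 α β, expectedTime M A t.1

/-- The cumulative log-likelihood ratio `λ^k(n)` of stream `k` at time `n`. -/
def llr (M : ∀ k, Stream (S k)) (ω : Path S) (n : ℕ) (k : Fin K) : ℝ :=
  ∑ i ∈ Finset.range n, Real.log ((M k).f₁ (ω k i) / (M k).f₀ (ω k i))

/-- The indices listing the entries of `x` in decreasing order (ties broken by the index):
`x (orderIndex x 0) ≥ x (orderIndex x 1) ≥ …`. -/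
def orderIndex (x : Fin K → ℝ) : Equiv.Perm (Fin K) := Tuple.sort (fun k => -x k)

/-- The order statistic `x^{(j)}`, the `j`-th largest entry of `x` for `1 ≤ j ≤ K`, with the
conventions `x^{(0)} = -∞` and `x^{(K+1)} = ∞`. -/
def orderStat (x : Fin K → ℝ) (j : ℕ) : EReal :=
  if j = 0 then ⊥
  else if h : j - 1 < K then ((x (orderIndex x ⟨j - 1, h⟩) : ℝ) : EReal)
  else ⊤

/-- The number of positive entries. -/
def numPos (x : Fin K → ℝ) : ℕ := (Finset.univ.filter (fun k => 0 < x k)).card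

/-- `inf {n ≥ 1 : Q n}`, equal to `∞` if there is no such `n`. -/
def firstTime (Q : ℕ → Prop) : ℕ∞ := ⨅ (n : ℕ) (_ : 1 ≤ n ∧ Q n), (n : ℕ∞)

/-- Stopping time `τ₁`. -/
def tau₁ (M : ∀ k, Stream (S k)) (ℓ : ℕ) (a c : ℝ) (ω : Path S) : ℕ∞ :=
  firstTime fun n => orderStat (llr M ω n) (ℓ + 1) ≤ ((-a : ℝ) : EReal) ∧
    (c : EReal) ≤ orderStat (llr M ω n) ℓ - orderStat (llr M ω n) (ℓ + 1)

/-- Stopping time `τ₂`. -/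
def tau₂ (M : ∀ k, Stream (S k)) (ℓ u : ℕ) (a b : ℝ) (ω : Path S) : ℕ∞ :=
  firstTime fun n => (ℓ ≤ numPos (llr M ω n) ∧ numPos (llr M ω n) ≤ u) ∧
    ∀ k, llr M ω n k ∉ Set.Ioo (-a) b

/-- Stopping time `τ₃`. -/
def tau₃ (M : ∀ k, Stream (S k)) (u : ℕ) (b d : ℝ) (ω : Path S) : ℕ∞ :=
  firstTime fun n => (b : EReal) ≤ orderStat (llr M ω n) u ∧
    (d : EReal) ≤ orderStat (llr M ω n) u - orderStat (llr M ω n) (u + 1)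

/-- The stopping time `T_GI = min {τ₁, τ₂, τ₃}` of the gap-intersection rule with thresholds
`a, b, c, d`. -/
def gapIntersectionTime (M : ∀ k, Stream (S k)) (ℓ u : ℕ) (a b c d : ℝ) (ω : Path S) : ℕ∞ :=
  min (tau₁ M ℓ a c ω) (min (tau₂ M ℓ u a b ω) (tau₃ M u b d ω))

/-- The decision of the gap-intersection rule: signal is declared in the `p'` streams with the
largest log-likelihood ratios at time `T_GI`, where `p'` is the number of positive log-likelihood
ratios at that time, truncated to `[ℓ, u]`. (If `T_GI = ∞`, the decision is a fixed set.) -/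
def gapIntersectionDecision (M : ∀ k, Stream (S k)) (ℓ u : ℕ) (a b c d : ℝ) (ω : Path S) :
    Finset (Fin K) :=
  let x : Fin K → ℝ := llr M ω (gapIntersectionTime M ℓ u a b c d ω).toNat
  (Finset.univ.filter (fun i : Fin K => i.val < min (max (numPos x) ℓ) u)).image (orderIndex x)

/-- `T_GI` with the thresholds
`a = |log β| + log K`, `b = |log α| + log K`, `c = |log α| + log ((K - ℓ) K)`,
`d = |log β| + log (u K)`. -/
def T_GI (M : ∀ k, Stream (S k)) (ℓ u : ℕ) (α β : ℝ) : Path S → ℕ∞ :=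
  gapIntersectionTime M ℓ u (|Real.log β| + Real.log K) (|Real.log α| + Real.log K)
    (|Real.log α| + Real.log (((K : ℝ) - ℓ) * K)) (|Real.log β| + Real.log ((u : ℝ) * K))

/-- `d_GI` with the same thresholds. -/
def d_GI (M : ∀ k, Stream (S k)) (ℓ u : ℕ) (α β : ℝ) : Path S → Finset (Fin K) :=
  gapIntersectionDecision M ℓ u (|Real.log β| + Real.log K) (|Real.log α| + Real.log K)
    (|Real.log α| + Real.log (((K : ℝ) - ℓ) * K)) (|Real.log β| + Real.log ((u : ℝ) * K))

/-- `η₁^A = min_{k ∈ A} D₁^k`, equal to `∞` for `A = ∅`. -/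
def η₁ (M : ∀ k, Stream (S k)) (A : Finset (Fin K)) : ℝ≥0∞ :=
  ⨅ k ∈ A, ENNReal.ofReal (M k).D₁

/-- `η₀^A = min_{k ∉ A} D₀^k`, equal to `∞` if `A` consists of all streams. -/
def η₀ (M : ∀ k, Stream (S k)) (A : Finset (Fin K)) : ℝ≥0∞ :=
  ⨅ k ∉ A, ENNReal.ofReal (M k).D₀

/-- `|log x|` as an extended nonnegative number. -/
def absLog (x : ℝ) : ℝ≥0∞ := ENNReal.ofReal |Real.log x|

/-- The explicit first-order value, in the regimes `|A| = ℓ`, `ℓ < |A| < u` and `|A| = u`. -/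
def firstOrder (M : ∀ k, Stream (S k)) (ℓ u : ℕ) (A : Finset (Fin K)) (α β : ℝ) : ℝ≥0∞ :=
  if A.card = ℓ then max (absLog β / η₀ M A) (absLog α / (η₀ M A + η₁ M A))
  else if A.card < u then max (absLog β / η₀ M A) (absLog α / η₁ M A)
  else max (absLog α / η₁ M A) (absLog β / (η₀ M A + η₁ M A))

/-- `F ∼ G` as `α, β → 0+` at arbitrary rates: `F / G → 1`. (With the conventions of `ℝ≥0∞` a ratio
involving `∞`, or with denominator `0`, is `0` or `∞`, so the limit forces `F` and `G` to be
eventually positive and finite.) -/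
def AsympEq (F G : ℝ → ℝ → ℝ≥0∞) : Prop :=
  Tendsto (fun q : ℝ × ℝ => F q.1 q.2 / G q.1 q.2) (𝓝[>] (0 : ℝ) ×ˢ 𝓝[>] (0 : ℝ)) (𝓝 1)

end SeqMultTest

end

/-!
The rule stops when the vector of the log-likelihood ratios `λ^k(n)` of the streams enters a fixed
region of `ℝ^K`, the union of the three regions that define `τ₁`, `τ₂` and `τ₃`. Most of the
argument rests on one identity (`P_eq_setLIntegral`): on the information `ℱ n` of the first `n`
observations, `P_A` has the density `exp (lrSum A C (llr n))` with respect to `P_C`, where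
`lrSum A C x = ∑_{k ∈ A \ C} x_k - ∑_{k ∈ C \ A} x_k`.

*Error control.* If the rule stops with a false positive, then either `λ^j ≥ b` for some `j ∉ A`, or
`λ^j - λ^i ≥ c` for some `j ∉ A` and `i ∈ A` (`exists_of_false_positive`). These quantities are the
log-likelihood ratios of `P_C` with respect to `P_A` for `C = A ∪ {j}` and `C = (A \ {i}) ∪ {j}`, so
the change of measure bounds the probabilities by `exp (-b)` and `exp (-c)` (`P_stop_mem_le`), and
the thresholds are such that the union bound gives `α`. False negatives are similar. That the rule
stops almost surely follows from the upper bound for its expected sample size.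

*Upper bound.* Under `P_A` every stream drifts in its own direction with speed `D₁^k` or `D₀^k`. As
`exp (-λ^k)` has mean one under the alternative, and `exp (λ^k)` under the null, Chernoff's bound
shows that the probability that some stream is slower than `r` times its speed at time `n` decays
geometrically (`exists_rate`). If no stream is slower, the rule has stopped as soon as `n` exceeds
`1 / r` times the explicit first-order value plus a constant, hence
`exists_expectedTime_T_GI_le`.

*Lower bound.* A test in the class decides for `A` with probability close to one under `P_A`, but
with probability at most `γ ∈ {α, β}` under a neighbouring hypothesis `P_C`. Changing the measure at
a deterministic time `n` a little smaller than `|log γ|` divided by the information number of `P_A`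
against `P_C`, and using the law of large numbers under `P_A`, one finds that `P_A(T ≤ n)` is small
(`exists_le_expectedTime`). Adding, removing or exchanging a stream gives the terms of the
first-order value (`eventually_firstOrder_le_optimalTime`).

As the rule belongs to the class, the optimum lies between the two bounds, and both asymptotic
equivalences follow (`tendsto_div_of_forall_bounds`).
-/

namespace SeqMultTest

/-! ### One observation: the log-likelihood ratio and exponential tilting -/

namespace Stream

variable {S : Type*} [MeasurableSpace S] (M : Stream S)

/-- The log-likelihood ratio `log (f₁ / f₀)` of one observation. -/
noncomputable def logLR (x : S) : ℝ := Real.log (M.f₁ x / M.f₀ x)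

@[fun_prop]
lemma measurable_logLR : Measurable M.logLR :=
  Real.measurable_log.comp (M.measurable_f₁.div M.measurable_f₀)

instance isProbabilityMeasure_law₀ : IsProbabilityMeasure M.law₀ :=
  ⟨by simp [law₀, M.lintegral_f₀]⟩

instance isProbabilityMeasure_law₁ : IsProbabilityMeasure M.law₁ :=
  ⟨by simp [law₁, M.lintegral_f₁]⟩

/-- Mutual absolute continuity says that the two densities vanish on the same set, up to a
null set. -/
lemma ae_eq_zero_iff : ∀ᵐ x ∂M.μ, M.f₀ x = 0 ↔ M.f₁ x = 0 := by
  have key : ∀ f g : S → ℝ, Measurable f → Measurable g → (∀ x, 0 ≤ f x) → (∀ x, 0 ≤ g x) →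
      M.μ.withDensity (fun x => ENNReal.ofReal (g x)) ≪
        M.μ.withDensity (fun x => ENNReal.ofReal (f x)) →
      ∀ᵐ x ∂M.μ, f x = 0 → g x = 0 := by
    intro f g hf hg hf0 hg0 h
    have hs : MeasurableSet {x | f x = 0} := hf (measurableSet_singleton 0)
    have h1 : M.μ.withDensity (fun x => ENNReal.ofReal (f x)) {x | f x = 0} = 0 := by
      rw [withDensity_apply _ hs, setLIntegral_congr_fun hs (g := fun _ => 0)]
      · simp
      · intro x hx
        have : f x = 0 := hx
        simp [this]
    have h2 := h h1
    rw [withDensity_apply _ hs, lintegral_eq_zero_iff (by fun_prop)] at h2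
    filter_upwards [(ae_restrict_iff' hs).1 h2] with x hx hfx
    have := hx hfx
    simp only [Pi.zero_apply, ENNReal.ofReal_eq_zero] at this
    exact le_antisymm this (hg0 x)
  filter_upwards [key _ _ M.measurable_f₀ M.measurable_f₁ M.nonneg_f₀ M.nonneg_f₁ M.ac₁₀,
    key _ _ M.measurable_f₁ M.measurable_f₀ M.nonneg_f₁ M.nonneg_f₀ M.ac₀₁] with x h1 h2
  exact ⟨h1, h2⟩

lemma law₁_eq_withDensity :
    M.law₁ = M.law₀.withDensity (fun x => ENNReal.ofReal (Real.exp (M.logLR x))) := by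
  have h0 : Measurable fun x => ENNReal.ofReal (M.f₀ x) := M.measurable_f₀.ennreal_ofReal
  rw [law₁, law₀, ← withDensity_mul _ h0 (by fun_prop)]
  refine withDensity_congr_ae ?_
  filter_upwards [M.ae_eq_zero_iff] with x hx
  rw [Pi.mul_apply, ← ENNReal.ofReal_mul (M.nonneg_f₀ x), logLR]
  rcases (M.nonneg_f₀ x).eq_or_lt with h | h
  · rw [hx.1 h.symm, ← h]; simp
  · have h1 : 0 < M.f₁ x := lt_of_le_of_ne (M.nonneg_f₁ x) fun h' => h.ne' (hx.2 h'.symm)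
    rw [Real.exp_log (div_pos h1 h), mul_div_cancel₀ _ h.ne']

lemma law₀_eq_withDensity :
    M.law₀ = M.law₁.withDensity (fun x => ENNReal.ofReal (Real.exp (-M.logLR x))) := by
  have h1 : Measurable fun x => ENNReal.ofReal (M.f₁ x) := M.measurable_f₁.ennreal_ofReal
  rw [law₁, law₀, ← withDensity_mul _ h1 (by fun_prop)]
  refine withDensity_congr_ae ?_
  filter_upwards [M.ae_eq_zero_iff] with x hx
  rw [Pi.mul_apply, ← ENNReal.ofReal_mul (M.nonneg_f₁ x), logLR, ← Real.log_inv, inv_div]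
  rcases (M.nonneg_f₁ x).eq_or_lt with h | h
  · rw [hx.2 h.symm, ← h]; simp
  · have h0 : 0 < M.f₀ x := lt_of_le_of_ne (M.nonneg_f₀ x) fun h' => h.ne' (hx.1 h'.symm)
    rw [Real.exp_log (div_pos h0 h), mul_div_cancel₀ _ h.ne']

lemma integral_law (f g : S → ℝ) (hf : Measurable f) (hf0 : ∀ x, 0 ≤ f x) :
    ∫ x, g x ∂M.μ.withDensity (fun x => ENNReal.ofReal (f x)) = ∫ x, g x * f x ∂M.μ := by
  rw [integral_withDensity_eq_integral_toReal_smul hf.ennreal_ofReal (by simp)]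
  simp [ENNReal.toReal_ofReal, hf0, mul_comm]

lemma integrable_law (f g : S → ℝ) (hf : Measurable f) (hf0 : ∀ x, 0 ≤ f x) :
    Integrable g (M.μ.withDensity (fun x => ENNReal.ofReal (f x))) ↔
      Integrable (fun x => g x * f x) M.μ := by
  rw [integrable_withDensity_iff_integrable_smul' hf.ennreal_ofReal (by simp)]
  simp [ENNReal.toReal_ofReal, hf0, mul_comm]

lemma integral_logLR_law₁ : ∫ x, M.logLR x ∂M.law₁ = M.D₁ :=
  M.integral_law _ _ M.measurable_f₁ M.nonneg_f₁

lemma neg_logLR (x : S) : -M.logLR x = Real.log (M.f₀ x / M.f₁ x) := by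
  rw [logLR, ← Real.log_inv, inv_div]

lemma integral_neg_logLR_law₀ : ∫ x, -M.logLR x ∂M.law₀ = M.D₀ := by
  simp_rw [neg_logLR]
  exact M.integral_law _ _ M.measurable_f₀ M.nonneg_f₀

lemma KLPosFinite.integrable_law₁ {M : Stream S} (h : M.KLPosFinite) :
    Integrable M.logLR M.law₁ :=
  (M.integrable_law _ _ M.measurable_f₁ M.nonneg_f₁).2 h.2.1

lemma KLPosFinite.integrable_law₀ {M : Stream S} (h : M.KLPosFinite) :
    Integrable M.logLR M.law₀ := by
  have : Integrable (fun x => -M.logLR x) M.law₀ := by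
    simp_rw [neg_logLR]
    exact (M.integrable_law _ _ M.measurable_f₀ M.nonneg_f₀).2 h.1
  simpa using this.neg

end Stream

variable {K : ℕ} {S : Fin K → Type*} [∀ k, MeasurableSpace (S k)]

/-! ### The product space: independence and change of measure -/

/-- The law of one observation of stream `k` under `P_A`. -/
noncomputable def obsLaw (M : ∀ k, Stream (S k)) (A : Finset (Fin K)) (k : Fin K) :
    Measure (S k) := if k ∈ A then (M k).law₁ else (M k).law₀

instance (M : ∀ k, Stream (S k)) (A : Finset (Fin K)) (k : Fin K) :
    IsProbabilityMeasure (obsLaw M A k) := by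
  unfold obsLaw; split_ifs <;> infer_instance

lemma P_eq_infinitePi (M : ∀ k, Stream (S k)) (A : Finset (Fin K)) :
    P M A = Measure.infinitePi fun k => Measure.infinitePi fun _ : ℕ => obsLaw M A k := by
  rw [Measure.infinitePi_eq_pi, P]
  congr 1
  funext k
  by_cases h : k ∈ A <;> simp [h, obsLaw, Stream.P₁, Stream.P₀]

instance (M : ∀ k, Stream (S k)) (A : Finset (Fin K)) : IsProbabilityMeasure (P M A) := by
  rw [P_eq_infinitePi]; infer_instance

/-- All observations, of all streams and at all times, are independent. -/
lemma iIndepFun_obs (M : ∀ k, Stream (S k)) (A : Finset (Fin K)) {E : Type*} [MeasurableSpace E]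
    {F : ∀ k, ℕ → S k → E} (hF : ∀ k i, Measurable (F k i)) :
    iIndepFun (fun (p : (_ : Fin K) × ℕ) (ω : Path S) => F p.1 p.2 (ω p.1 p.2)) (P M A) := by
  rw [P_eq_infinitePi]
  exact iIndepFun_uncurry_infinitePi (fun k (_ : ℕ) => obsLaw M A k) hF

lemma map_obs (M : ∀ k, Stream (S k)) (A : Finset (Fin K)) (k : Fin K) (i : ℕ) :
    (P M A).map (fun ω : Path S => ω k i) = obsLaw M A k := by
  rw [P_eq_infinitePi]
  have h := Measure.infinitePi_map_eval
    (fun k => Measure.infinitePi fun _ : ℕ => obsLaw M A k) k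
  have h' := Measure.infinitePi_map_eval (fun _ : ℕ => obsLaw M A k) i
  rw [← h, Measure.map_map (measurable_pi_apply i) (measurable_pi_apply k)] at h'
  exact h'

lemma lintegral_prod_obs (M : ∀ k, Stream (S k)) (A : Finset (Fin K))
    {F : ∀ k, ℕ → S k → ℝ≥0∞} (hF : ∀ k i, Measurable (F k i)) (I : Finset ((_ : Fin K) × ℕ)) :
    ∫⁻ ω, ∏ p ∈ I, F p.1 p.2 (ω p.1 p.2) ∂(P M A) =
      ∏ p ∈ I, ∫⁻ x, F p.1 p.2 x ∂(obsLaw M A p.1) := by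
  rw [lintegral_prod_eq_prod_lintegral_of_indepFun I _ (iIndepFun_obs M A hF)]
  · refine Finset.prod_congr rfl fun p _ => ?_
    rw [← map_obs M A p.1 p.2, lintegral_map (hF _ _) (by fun_prop)]
  · intro p
    exact (hF _ _).comp (by fun_prop)

/-- The coefficient of `λ^k` in the log-likelihood ratio of `P_A` with respect to `P_C`: `1` if
`k ∈ A \ C`, `-1` if `k ∈ C \ A`, and `0` otherwise. -/
noncomputable def coeff (A C : Finset (Fin K)) (k : Fin K) : ℝ :=
  (if k ∈ A then 1 else 0) - (if k ∈ C then 1 else 0)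

/-- The log-likelihood ratio of `P_A` with respect to `P_C`, as a function of the vector
of the log-likelihood ratios of the streams. -/
noncomputable def lrSum (A C : Finset (Fin K)) (x : Fin K → ℝ) : ℝ := ∑ k, coeff A C k * x k

lemma obsLaw_eq_withDensity (M : ∀ k, Stream (S k)) (A C : Finset (Fin K)) (k : Fin K) :
    obsLaw M A k = (obsLaw M C k).withDensity
      (fun x => ENNReal.ofReal (Real.exp (coeff A C k * (M k).logLR x))) := by
  by_cases hA : k ∈ A <;> by_cases hC : k ∈ C <;>
    simp only [obsLaw, coeff, hA, hC, if_true, if_false]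
  · simp
  · simpa using (M k).law₁_eq_withDensity
  · simpa using (M k).law₀_eq_withDensity
  · simp

lemma llr_eq (M : ∀ k, Stream (S k)) (ω : Path S) (n : ℕ) (k : Fin K) :
    llr M ω n k = ∑ i ∈ Finset.range n, (M k).logLR (ω k i) := rfl

@[fun_prop]
lemma measurable_llr (M : ∀ k, Stream (S k)) (n : ℕ) : Measurable fun ω => llr M ω n := by
  refine measurable_pi_lambda _ fun k => ?_
  simp_rw [llr_eq]
  fun_prop

@[fun_prop]
lemma measurable_lrSum (A C : Finset (Fin K)) : Measurable (lrSum A C) := by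
  unfold lrSum; fun_prop

lemma measurable_obs_ℱ {n i : ℕ} (k : Fin K) (hi : i < n) :
    Measurable[ℱ S n] fun ω : Path S => ω k i := by
  rw [measurable_iff_comap_le]
  exact le_iSup_of_le k (le_iSup_of_le i (le_iSup_of_le hi le_rfl))

lemma measurable_llr_ℱ (M : ∀ k, Stream (S k)) (n : ℕ) :
    Measurable[ℱ S n] fun ω => llr M ω n := by
  refine @measurable_pi_lambda _ _ _ (ℱ S n) _ _ fun k => ?_
  simp_rw [llr_eq]
  refine @Finset.measurable_fun_sum _ _ _ _ _ _ (ℱ S n) _ _ fun i hi => ?_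
  exact (M k).measurable_logLR.comp (measurable_obs_ℱ k (Finset.mem_range.1 hi))

lemma exp_lrSum_llr (M : ∀ k, Stream (S k)) (A C : Finset (Fin K)) (n : ℕ) (ω : Path S) :
    ENNReal.ofReal (Real.exp (lrSum A C (llr M ω n))) =
      ∏ p ∈ Finset.univ.sigma fun _ : Fin K => Finset.range n,
        ENNReal.ofReal (Real.exp (coeff A C p.1 * (M p.1).logLR (ω p.1 p.2))) := by
  rw [← ENNReal.ofReal_prod_of_nonneg fun _ _ => (Real.exp_pos _).le, ← Real.exp_sum,
    Finset.sum_sigma]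
  simp [lrSum, llr_eq, Finset.mul_sum]

lemma indicator_eq_indicator_one_mul {X : Type*} (s : Set X) (g : X → ℝ≥0∞) (x : X) :
    s.indicator g x = s.indicator (fun _ => 1) x * g x := by
  by_cases h : x ∈ s <;> simp [h]

/-- Wald's likelihood ratio identity at a fixed time: on `ℱ n`, the measure `P_A` has density
`exp (lrSum A C (llr n))` with respect to `P_C`. Both sides are finite measures, and they agree on
the sets `{∀ (k, i) ∈ t, X_i^k ∈ f (k, i)}`, which form a π-system that generates `ℱ n`. -/
theorem P_eq_setLIntegral (M : ∀ k, Stream (S k)) (A C : Finset (Fin K)) (n : ℕ) {E : Set (Path S)}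
    (hE : MeasurableSet[ℱ S n] E) :
    P M A E = ∫⁻ ω in E, ENNReal.ofReal (Real.exp (lrSum A C (llr M ω n))) ∂(P M C) := by
  set Q := (P M C).withDensity fun ω => ENNReal.ofReal (Real.exp (lrSum A C (llr M ω n)))
    with hQ
  classical
  set I : Finset ((_ : Fin K) × ℕ) := Finset.univ.sigma fun _ : Fin K => Finset.range n with hI
  let m : ((_ : Fin K) × ℕ) → MeasurableSpace (Path S) := fun p =>
    MeasurableSpace.comap (fun ω : Path S => ω p.1 p.2) inferInstance
  have hgen : (ℱ S n : MeasurableSpace (Path S)) = MeasurableSpace.generateFrom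
      (piiUnionInter (fun p => {s | MeasurableSet[m p] s}) (I : Set ((_ : Fin K) × ℕ))) := by
    rw [generateFrom_piiUnionInter_measurableSet m]
    apply le_antisymm
    · refine iSup_le fun k => iSup_le fun i => iSup_le fun hi => ?_
      exact le_iSup₂_of_le (f := fun p (_ : p ∈ (I : Set ((_ : Fin K) × ℕ))) => m p) ⟨k, i⟩
        (by simpa [hI] using hi) le_rfl
    · refine iSup₂_le fun p hp => ?_
      have : p.2 < n := by simpa [hI] using hp
      exact le_iSup_of_le p.1 (le_iSup_of_le p.2 (le_iSup_of_le this le_rfl))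
  have hpi := isPiSystem_piiUnionInter (fun p => {s | MeasurableSet[m p] s})
    (fun p => @MeasurableSpace.isPiSystem_measurableSet _ (m p)) (I : Set ((_ : Fin K) × ℕ))
  have hbox : ∀ s ∈ piiUnionInter (fun p => {s | MeasurableSet[m p] s})
      (I : Set ((_ : Fin K) × ℕ)), P M A s = Q s := by
    rintro s ⟨t, htI, f, hf, rfl⟩
    -- the set is a box; enlarge its index set to `I` by means of trivial constraints
    have hb : ∃ b : ∀ k, ℕ → Set (S k), (∀ k i, MeasurableSet (b k i)) ∧
        (⋂ x ∈ t, f x) = {ω : Path S | ∀ p ∈ I, ω p.1 p.2 ∈ b p.1 p.2} := by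
      choose! g hg hgf using hf
      refine ⟨fun k i => if (⟨k, i⟩ : (_ : Fin K) × ℕ) ∈ t then g ⟨k, i⟩ else Set.univ, ?_, ?_⟩
      · intro k i
        dsimp only
        split_ifs with h
        · exact hg _ h
        · exact MeasurableSet.univ
      · ext ω
        simp only [Set.mem_iInter, Set.mem_ofPred_eq]
        constructor
        · intro h p _
          split_ifs with hpt
          · have := h _ hpt
            rw [← hgf _ hpt] at this
            exact this
          · trivial
        · intro h p hpt
          have := h p (htI hpt)
          rw [if_pos hpt] at this
          rw [← hgf _ hpt]
          exact this
    obtain ⟨b, hbm, hbe⟩ := hb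
    have hms : MeasurableSet {ω : Path S | ∀ p ∈ I, ω p.1 p.2 ∈ b p.1 p.2} := by
      have : {ω : Path S | ∀ p ∈ I, ω p.1 p.2 ∈ b p.1 p.2} =
          ⋂ p ∈ I, (fun ω : Path S => ω p.1 p.2) ⁻¹' b p.1 p.2 := by ext; simp
      rw [this]
      refine Finset.measurableSet_biInter _ fun p _ => ?_
      exact (by fun_prop : Measurable fun ω : Path S => ω p.1 p.2) (hbm _ _)
    have hind : ∀ (ω : Path S),
        Set.indicator {ω : Path S | ∀ p ∈ I, ω p.1 p.2 ∈ b p.1 p.2} (fun _ => (1 : ℝ≥0∞)) ω =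
          ∏ p ∈ I, Set.indicator (b p.1 p.2) (fun _ => (1 : ℝ≥0∞)) (ω p.1 p.2) := by
      intro ω
      by_cases h : ∀ p ∈ I, ω p.1 p.2 ∈ b p.1 p.2
      · rw [Set.indicator_of_mem (by exact h)]
        exact (Finset.prod_eq_one fun p hp => Set.indicator_of_mem (h p hp) _).symm
      · rw [Set.indicator_of_notMem (by exact h)]
        push Not at h
        obtain ⟨p, hp, hp'⟩ := h
        exact (Finset.prod_eq_zero hp (Set.indicator_of_notMem hp' _)).symm
    rw [hbe, hQ, withDensity_apply _ hms, ← lintegral_indicator hms]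
    have h1 : P M A {ω : Path S | ∀ p ∈ I, ω p.1 p.2 ∈ b p.1 p.2} =
        ∏ p ∈ I, obsLaw M A p.1 (b p.1 p.2) := by
      rw [← lintegral_indicator_one hms]
      simp_rw [Pi.one_def, hind]
      rw [lintegral_prod_obs M A (F := fun k i => Set.indicator (b k i) (fun _ => (1 : ℝ≥0∞)))
        fun k i => measurable_const.indicator (hbm k i)]
      refine Finset.prod_congr rfl fun p _ => ?_
      exact lintegral_indicator_one (hbm _ _)
    rw [h1]
    have h2 : ∀ ω : Path S, Set.indicator {ω : Path S | ∀ p ∈ I, ω p.1 p.2 ∈ b p.1 p.2}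
        (fun ω => ENNReal.ofReal (Real.exp (lrSum A C (llr M ω n)))) ω =
        ∏ p ∈ I, Set.indicator (b p.1 p.2) (fun x =>
          ENNReal.ofReal (Real.exp (coeff A C p.1 * (M p.1).logLR x))) (ω p.1 p.2) := by
      intro ω
      rw [indicator_eq_indicator_one_mul, hind, exp_lrSum_llr, ← Finset.prod_mul_distrib]
      exact Finset.prod_congr rfl fun p _ => (indicator_eq_indicator_one_mul (b p.1 p.2)
        (fun x => ENNReal.ofReal (Real.exp (coeff A C p.1 * (M p.1).logLR x))) _).symm
    simp_rw [h2]
    rw [lintegral_prod_obs M C (F := fun k i => Set.indicator (b k i) (fun x =>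
          ENNReal.ofReal (Real.exp (coeff A C k * (M k).logLR x))))
        fun k i => Measurable.indicator (by fun_prop) (hbm k i)]
    refine Finset.prod_congr rfl fun p _ => ?_
    rw [lintegral_indicator (hbm _ _), ← withDensity_apply _ (hbm _ _), ← obsLaw_eq_withDensity]
  have huniv : P M A Set.univ = Q Set.univ := by
    refine hbox _ ⟨∅, by simp, fun _ => Set.univ, by simp, by simp⟩
  have hle := (ℱ S).le n
  rw [ext_on_measurableSpace_of_generate_finite inferInstance (μ := P M A) (ν := Q) _ hbox hle
    hgen hpi huniv hE, hQ, withDensity_apply _ (hle _ hE)]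

lemma P_le_exp_mul (M : ∀ k, Stream (S k)) (A C : Finset (Fin K)) (n : ℕ) {E : Set (Path S)}
    (hE : MeasurableSet[ℱ S n] E) {c : ℝ} (hc : ∀ ω ∈ E, lrSum A C (llr M ω n) ≤ c) :
    P M A E ≤ ENNReal.ofReal (Real.exp c) * P M C E := by
  rw [P_eq_setLIntegral M A C n hE, ← setLIntegral_const]
  refine setLIntegral_mono' ((ℱ S).le n _ hE) fun ω hω => ?_
  exact ENNReal.ofReal_le_ofReal (Real.exp_le_exp.2 (hc ω hω))

/-- If stopping at `T` with the log-likelihood ratios in `G` forces the log-likelihood ratio of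
`P_A` with respect to `P_C` to be at most `-b`, then this event has `P_A`-probability at
most `exp (-b)`. -/
lemma P_stop_mem_le (M : ∀ k, Stream (S k)) (A C : Finset (Fin K)) {T : Path S → ℕ∞}
    (hT : IsStoppingTime (ℱ S) T) {G : Set (Fin K → ℝ)} (hG : MeasurableSet G) {b : ℝ}
    (hb : ∀ x ∈ G, lrSum A C x ≤ -b) :
    P M A {ω | ∃ n : ℕ, T ω = n ∧ llr M ω n ∈ G} ≤ ENNReal.ofReal (Real.exp (-b)) := by
  set E : ℕ → Set (Path S) := fun n => {ω | T ω = n} ∩ {ω | llr M ω n ∈ G} with hE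
  have hEm : ∀ n, MeasurableSet[ℱ S n] (E n) := fun n =>
    @MeasurableSet.inter _ (ℱ S n) _ _ (hT.measurableSet_eq n) (measurable_llr_ℱ M n hG)
  have hEm' : ∀ n, MeasurableSet (E n) := fun n => (ℱ S).le n _ (hEm n)
  have hdisj : Pairwise (Function.onFun Disjoint E) := by
    intro m n hmn
    refine Set.disjoint_left.2 fun ω hm hn => hmn ?_
    have h1 : T ω = m := hm.1
    have h2 : T ω = n := hn.1
    exact_mod_cast h1.symm.trans h2
  have hU : {ω | ∃ n : ℕ, T ω = n ∧ llr M ω n ∈ G} = ⋃ n, E n := by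
    ext ω; simp [hE]
  rw [hU]
  calc P M A (⋃ n, E n) ≤ ∑' n, P M A (E n) := measure_iUnion_le _
    _ ≤ ∑' n, ENNReal.ofReal (Real.exp (-b)) * P M C (E n) :=
        ENNReal.tsum_le_tsum fun n => P_le_exp_mul M A C n (hEm n) fun ω hω => hb _ hω.2
    _ = ENNReal.ofReal (Real.exp (-b)) * P M C (⋃ n, E n) := by
        rw [ENNReal.tsum_mul_left, measure_iUnion hdisj hEm']
    _ ≤ ENNReal.ofReal (Real.exp (-b)) * 1 := by gcongr; exact prob_le_one
    _ = _ := mul_one _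

/-! ### Large deviations and the law of large numbers for the log-likelihood ratios -/

/-- A variable with positive mean and integrable `exp (-Z)` has a negative exponential moment
below `1`: the right derivative of `s ↦ E[exp (-s Z)]` at `0` is `-E[Z] < 0`. -/
lemma exists_lintegral_exp_neg_mul_lt_one {X : Type*} [MeasurableSpace X] {ν : Measure X}
    [IsProbabilityMeasure ν] {Z : X → ℝ} (hZm : Measurable Z) (hZ : Integrable Z ν)
    (hexp : Integrable (fun x => Real.exp (-Z x)) ν) (hpos : 0 < ∫ x, Z x ∂ν) :
    ∃ s : ℝ, 0 < s ∧ ∫⁻ x, ENNReal.ofReal (Real.exp (-(s * Z x))) ∂ν < 1 := by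
  have hs0 : ∀ n : ℕ, (0 : ℝ) < 1 / ((n : ℝ) + 1) := fun n => Nat.one_div_pos_of_nat
  have hs1 : ∀ n : ℕ, 1 / ((n : ℝ) + 1) ≤ 1 := fun n => by
    rw [div_le_one (by positivity)]; linarith [n.cast_nonneg (α := ℝ)]
  have hconv : ∀ s z : ℝ, 0 ≤ s → s ≤ 1 → Real.exp (-(s * z)) ≤ (1 - s) + s * Real.exp (-z) := by
    intro s z h0 h1
    have := convexOn_exp.2 (Set.mem_univ (0 : ℝ)) (Set.mem_univ (-z)) (sub_nonneg.2 h1) h0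
      (by ring)
    simpa using this
  have hlim : Tendsto (fun n : ℕ => ∫ x, (1 / ((n : ℝ) + 1))⁻¹ *
      (Real.exp (-((1 / ((n : ℝ) + 1)) * Z x)) - 1) ∂ν) atTop (𝓝 (∫ x, -Z x ∂ν)) := by
    refine tendsto_integral_of_dominated_convergence (fun x => |Z x| + (Real.exp (-Z x) + 1))
      (fun n => by fun_prop) (hZ.abs.add (hexp.add (integrable_const 1))) ?_ ?_
    · intro n
      refine ae_of_all _ fun x => ?_
      set s : ℝ := 1 / ((n : ℝ) + 1)
      have hs := hs0 n
      have h1 := hconv s (Z x) hs.le (hs1 n)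
      have h2 := Real.add_one_le_exp (-(s * Z x))
      have h3 : s⁻¹ * (Real.exp (-(s * Z x)) - 1) ≤ Real.exp (-Z x) - 1 := by
        rw [inv_mul_le_iff₀ hs]; linarith
      have h4 : -Z x ≤ s⁻¹ * (Real.exp (-(s * Z x)) - 1) := by
        rw [le_inv_mul_iff₀ hs]; linarith
      rw [Real.norm_eq_abs, abs_le]
      have h5 := Real.exp_pos (-Z x)
      constructor <;> linarith [neg_abs_le (Z x), le_abs_self (Z x), abs_nonneg (Z x)]
    · refine ae_of_all _ fun x => ?_
      have hd : HasDerivAt (fun s : ℝ => Real.exp (-(s * Z x))) (-Z x) 0 := by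
        have := (((hasDerivAt_id (0 : ℝ)).mul_const (Z x)).neg).exp
        simpa using this
      have ht := hd.tendsto_slope_zero
      have hs : Tendsto (fun n : ℕ => 1 / ((n : ℝ) + 1)) atTop (𝓝[≠] 0) :=
        tendsto_nhdsWithin_iff.2 ⟨tendsto_one_div_add_atTop_nhds_zero_nat,
          Eventually.of_forall fun n => (hs0 n).ne'⟩
      simpa [Function.comp_def] using ht.comp hs
  rw [integral_neg] at hlim
  obtain ⟨n, hn⟩ := (hlim.eventually_lt_const (neg_lt_zero.2 hpos)).exists
  refine ⟨1 / ((n : ℝ) + 1), hs0 n, ?_⟩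
  set s : ℝ := 1 / ((n : ℝ) + 1)
  have hint : Integrable (fun x => Real.exp (-(s * Z x))) ν := by
    refine Integrable.mono' ((integrable_const (1 - s)).add (hexp.const_mul s)) (by fun_prop)
      (ae_of_all _ fun x => ?_)
    rw [Real.norm_eq_abs, abs_of_pos (Real.exp_pos _)]
    exact hconv s (Z x) (hs0 n).le (hs1 n)
  rw [integral_const_mul, integral_sub hint (integrable_const 1)] at hn
  have h1 : ∫ x, Real.exp (-(s * Z x)) ∂ν < 1 := by
    have := (mul_neg_iff.1 hn).resolve_right fun h => absurd h.1 (not_lt.2 (inv_pos.2 (hs0 n)).le)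
    simpa using this.2
  rw [← ofReal_integral_eq_lintegral_ofReal hint (ae_of_all _ fun x => (Real.exp_pos _).le)]
  exact ENNReal.ofReal_lt_one.2 h1

/-- The direction in which `λ^k` drifts under `P_A`: up if `k ∈ A`, down otherwise. -/
noncomputable def driftSign (A : Finset (Fin K)) (k : Fin K) : ℝ := if k ∈ A then 1 else -1

/-- The speed at which `λ^k` drifts under `P_A`: `D₁^k` if `k ∈ A`, and `D₀^k` otherwise. -/
noncomputable def drift (M : ∀ k, Stream (S k)) (A : Finset (Fin K)) (k : Fin K) : ℝ :=
  if k ∈ A then (M k).D₁ else (M k).D₀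

variable {M : ∀ k, Stream (S k)}

lemma drift_pos (hKL : ∀ k, (M k).KLPosFinite) (A : Finset (Fin K)) (k : Fin K) :
    0 < drift M A k := by
  unfold drift; split_ifs
  exacts [(hKL k).2.2.2, (hKL k).2.2.1]

lemma integrable_logLR (hKL : ∀ k, (M k).KLPosFinite) (A : Finset (Fin K)) (k : Fin K) :
    Integrable (M k).logLR (obsLaw M A k) := by
  unfold obsLaw; split_ifs
  exacts [(hKL k).integrable_law₁, (hKL k).integrable_law₀]

lemma integral_driftSign_mul_logLR (A : Finset (Fin K)) (k : Fin K) :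
    ∫ x, driftSign A k * (M k).logLR x ∂(obsLaw M A k) = drift M A k := by
  by_cases h : k ∈ A
  · simp [obsLaw, drift, driftSign, h, Stream.integral_logLR_law₁]
  · simpa [obsLaw, drift, driftSign, h] using (M k).integral_neg_logLR_law₀

lemma integrable_exp_neg_driftSign_mul_logLR (A : Finset (Fin K)) (k : Fin K) :
    Integrable (fun x => Real.exp (-(driftSign A k * (M k).logLR x))) (obsLaw M A k) := by
  refine ⟨by fun_prop, ?_⟩
  rw [hasFiniteIntegral_iff_ofReal (ae_of_all _ fun x => (Real.exp_pos _).le)]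
  by_cases h : k ∈ A
  · have h1 : (M k).law₀ Set.univ = 1 := measure_univ
    rw [Stream.law₀_eq_withDensity, withDensity_apply _ MeasurableSet.univ,
      setLIntegral_univ] at h1
    simp [obsLaw, driftSign, h, h1]
  · have h1 : (M k).law₁ Set.univ = 1 := measure_univ
    rw [Stream.law₁_eq_withDensity, withDensity_apply _ MeasurableSet.univ,
      setLIntegral_univ] at h1
    simp [obsLaw, driftSign, h, h1]

lemma prod_obs_single (A : Finset (Fin K)) (k : Fin K) (n : ℕ) {f : S k → ℝ≥0∞}
    (hf : Measurable f) :
    ∫⁻ ω, ∏ i ∈ Finset.range n, f (ω k i) ∂(P M A) = (∫⁻ x, f x ∂(obsLaw M A k)) ^ n := by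
  have hind : iIndepFun (fun (i : ℕ) (ω : Path S) => f (ω k i)) (P M A) := by
    have := iIndepFun_obs M A (F := fun k' _ => if h : k' = k then fun x => f (h ▸ x) else 0)
      (by
        intro k' i
        split_ifs with h
        · subst h; exact hf
        · exact measurable_const)
    have h2 := this.precomp (g := fun i : ℕ => (⟨k, i⟩ : (_ : Fin K) × ℕ))
      (fun i j hij => by simpa using hij)
    simpa using h2
  rw [lintegral_prod_eq_prod_lintegral_of_indepFun _ _ hind fun i => hf.comp (by fun_prop)]
  rw [Finset.prod_congr rfl fun i _ => show _ = ∫⁻ x, f x ∂(obsLaw M A k) from ?_]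
  · simp
  · rw [← map_obs M A k i, lintegral_map hf (by fun_prop)]

/-- Chernoff's bound. No moment assumption beyond `D₀, D₁ < ∞` is needed, since
`exp (-driftSign A k * logLR)` has mean one under `P_A`. -/
lemma exists_rate (hKL : ∀ k, (M k).KLPosFinite) (A : Finset (Fin K)) {r : ℝ} (hr : r < 1)
    (k : Fin K) : ∃ ρ : ℝ≥0∞, ρ < 1 ∧ ∀ n : ℕ,
      P M A {ω | driftSign A k * llr M ω n k ≤ r * drift M A k * n} ≤ ρ ^ n := by
  set Z : S k → ℝ := fun x => driftSign A k * (M k).logLR x - r * drift M A k with hZ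
  have hi1 : Integrable (fun x => driftSign A k * (M k).logLR x) (obsLaw M A k) :=
    (integrable_logLR hKL A k).const_mul _
  have hZi : Integrable Z (obsLaw M A k) := hi1.sub (integrable_const _)
  have hZe : Integrable (fun x => Real.exp (-Z x)) (obsLaw M A k) := by
    have := (integrable_exp_neg_driftSign_mul_logLR (M := M) A k).mul_const
      (Real.exp (r * drift M A k))
    refine this.congr (ae_of_all _ fun x => ?_)
    simp only [hZ]
    rw [← Real.exp_add]; congr 1; ring
  have hZp : 0 < ∫ x, Z x ∂(obsLaw M A k) := by
    rw [hZ, integral_sub hi1 (integrable_const _), integral_driftSign_mul_logLR]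
    have := drift_pos hKL A k
    simp only [integral_const, probReal_univ, one_smul]
    nlinarith
  obtain ⟨s, hs, hlt⟩ := exists_lintegral_exp_neg_mul_lt_one (by fun_prop) hZi hZe hZp
  refine ⟨_, hlt, fun n => ?_⟩
  rw [← prod_obs_single A k n (f := fun x => ENNReal.ofReal (Real.exp (-(s * Z x))))
    (by fun_prop)]
  have key : ∀ ω : Path S, ∏ i ∈ Finset.range n, ENNReal.ofReal (Real.exp (-(s * Z (ω k i)))) =
      ENNReal.ofReal (Real.exp (-(s * (driftSign A k * llr M ω n k - r * drift M A k * n)))) := by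
    intro ω
    rw [← ENNReal.ofReal_prod_of_nonneg fun _ _ => (Real.exp_pos _).le, ← Real.exp_sum]
    congr 2
    simp only [hZ, llr_eq, Finset.sum_neg_distrib, ← Finset.mul_sum, Finset.sum_sub_distrib,
      Finset.sum_const, Finset.card_range, nsmul_eq_mul]
    ring
  simp_rw [key]
  have hm : MeasurableSet {ω | driftSign A k * llr M ω n k ≤ r * drift M A k * n} :=
    measurableSet_le (by fun_prop) measurable_const
  rw [← lintegral_indicator_one hm]
  refine lintegral_mono fun ω => ?_
  by_cases h : ω ∈ {ω | driftSign A k * llr M ω n k ≤ r * drift M A k * n}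
  · rw [Set.indicator_of_mem h, Pi.one_apply, ENNReal.one_le_ofReal, Real.one_le_exp_iff]
    have h' : driftSign A k * llr M ω n k ≤ r * drift M A k * n := h
    nlinarith
  · rw [Set.indicator_of_notMem h]; exact zero_le

/-- At time `n`, every log-likelihood ratio has moved in the direction of its drift under `P_A`,
and by more than the fraction `r` of its expected displacement `drift M A k * n`. -/
def DriftsFast (M : ∀ k, Stream (S k)) (A : Finset (Fin K)) (r : ℝ) (n : ℕ) (ω : Path S) : Prop :=
  ∀ k, r * drift M A k * n < driftSign A k * llr M ω n k

lemma coe_eq_tsum_ite (t : ℕ∞) :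
    (t : ℝ≥0∞) = ∑' n : ℕ, if (n : ℕ∞) < t then (1 : ℝ≥0∞) else 0 := by
  induction t using ENat.recTopCoe with
  | top => simp
  | coe m =>
    rw [tsum_eq_sum (s := Finset.range m) (by intro n hn; simpa using hn)]
    rw [Finset.sum_congr rfl fun n hn => if_pos (by simpa using hn)]
    simp

/-- If `T ≤ n` whenever `n ≥ n₀` and all streams drift fast at time `n`, then the expected value of
`T` exceeds `n₀` by at most a constant, since the probabilities that this fails are summable. -/
lemma exists_expectedTime_le (hKL : ∀ k, (M k).KLPosFinite) (A : Finset (Fin K)) {r : ℝ}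
    (hr : r < 1) : ∃ C : ℝ, ∀ (T : Path S → ℕ∞) (n₀ : ℕ),
      (∀ n : ℕ, n₀ ≤ n → ∀ ω, DriftsFast M A r n ω → T ω ≤ n) →
      expectedTime M A T ≤ ENNReal.ofReal (n₀ + C) := by
  choose ρ hρ hb using fun k => exists_rate hKL A hr k
  set bad : ℕ → Set (Path S) := fun n =>
    ⋃ k, {ω | driftSign A k * llr M ω n k ≤ r * drift M A k * n} with hbad
  have hbadm : ∀ n, MeasurableSet (bad n) := fun n => MeasurableSet.iUnion fun k =>
    measurableSet_le (by fun_prop) measurable_const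
  have hsum : ∑' n, P M A (bad n) ≤ ∑ k, (1 - ρ k)⁻¹ := by
    calc ∑' n, P M A (bad n) ≤ ∑' n, ∑ k, ρ k ^ n := by
          refine ENNReal.tsum_le_tsum fun n => ?_
          refine (measure_iUnion_le _).trans ?_
          rw [tsum_fintype]
          exact Finset.sum_le_sum fun k _ => hb k n
      _ = ∑ k, ∑' n, ρ k ^ n := Summable.tsum_finsetSum fun _ _ => ENNReal.summable
      _ = _ := by simp_rw [ENNReal.tsum_geometric]
  have hfin : ∑ k, (1 - ρ k)⁻¹ ≠ ∞ := by
    refine ENNReal.sum_ne_top.2 fun k _ => ?_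
    rw [ENNReal.inv_ne_top]
    exact (tsub_pos_of_lt (hρ k)).ne'
  refine ⟨(∑ k, (1 - ρ k)⁻¹).toReal, fun T n₀ hT => ?_⟩
  rw [ENNReal.ofReal_add (by positivity) ENNReal.toReal_nonneg, ENNReal.ofReal_toReal hfin,
    ENNReal.ofReal_natCast]
  have hpt : ∀ ω, (T ω : ℝ≥0∞) ≤ n₀ + ∑' n, (bad n).indicator 1 ω := by
    intro ω
    rw [coe_eq_tsum_ite, ← ENat.toENNReal_coe n₀, coe_eq_tsum_ite n₀, ← ENNReal.tsum_add]
    refine ENNReal.tsum_le_tsum fun n => ?_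
    by_cases h1 : n < n₀
    · have h1' : (n : ℕ∞) < n₀ := by exact_mod_cast h1
      rw [if_pos h1']
      refine le_add_right ?_
      split_ifs <;> simp
    · by_cases h2 : ω ∈ bad n
      · rw [Set.indicator_of_mem h2]
        refine le_add_left ?_
        split_ifs <;> simp
      · have : T ω ≤ n := by
          refine hT n (not_lt.1 h1) ω fun k => ?_
          simp only [hbad, Set.mem_iUnion, Set.mem_ofPred_eq, not_exists, not_le] at h2
          exact h2 k
        rw [if_neg (not_lt.2 this)]
        exact zero_le
  calc expectedTime M A T ≤ ∫⁻ ω, (n₀ + ∑' n, (bad n).indicator 1 ω) ∂(P M A) :=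
        lintegral_mono hpt
    _ = n₀ + ∑' n, P M A (bad n) := by
        rw [lintegral_add_left measurable_const, lintegral_tsum fun n =>
          (measurable_one.indicator (hbadm n)).aemeasurable]
        simp [hbadm]
    _ ≤ _ := by gcongr

/-- The strong law of large numbers for the log-likelihood ratio of one stream. -/
lemma ae_tendsto_llr_div (hKL : ∀ k, (M k).KLPosFinite) (A : Finset (Fin K)) (k : Fin K) :
    ∀ᵐ ω ∂(P M A), Tendsto (fun n : ℕ => llr M ω n k / n) atTop
      (𝓝 (driftSign A k * drift M A k)) := by
  have hmap : ∀ i, Measurable fun ω : Path S => ω k i := fun i => by fun_prop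
  have hX : ∀ i, IdentDistrib (fun ω : Path S => (M k).logLR (ω k i))
      (fun ω : Path S => (M k).logLR (ω k 0)) (P M A) (P M A) := by
    intro i
    have h : IdentDistrib (fun ω : Path S => ω k i) (fun ω : Path S => ω k 0) (P M A) (P M A) :=
      ⟨(hmap i).aemeasurable, (hmap 0).aemeasurable, by rw [map_obs, map_obs]⟩
    exact h.comp (M k).measurable_logLR
  have hint : Integrable (fun ω : Path S => (M k).logLR (ω k 0)) (P M A) := by
    have := integrable_logLR hKL A k
    rw [← map_obs M A k 0] at this
    exact this.comp_measurable (hmap 0)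
  have hind : Pairwise (Function.onFun (fun f g => IndepFun f g (P M A))
      fun (i : ℕ) (ω : Path S) => (M k).logLR (ω k i)) := by
    intro i j hij
    exact (iIndepFun_obs M A (F := fun k _ => (M k).logLR)
      fun k _ => (M k).measurable_logLR).indepFun (i := ⟨k, i⟩) (j := ⟨k, j⟩) (by simpa using hij)
  have hmean : ∫ ω : Path S, (M k).logLR (ω k 0) ∂(P M A) = driftSign A k * drift M A k := by
    rw [← integral_driftSign_mul_logLR, integral_const_mul, ← mul_assoc]
    have : driftSign A k * driftSign A k = 1 := by unfold driftSign; split_ifs <;> norm_num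
    rw [this, one_mul, ← map_obs M A k 0, integral_map (hmap 0).aemeasurable (by fun_prop)]
  rw [← hmean]
  exact strong_law_ae_real _ hint hind hX

/-- The Kullback–Leibler information per unit of time between `P_A` and `P_C`: the sum of the
drifts of the streams on which `A` and `C` differ. -/
noncomputable def infoSum (M : ∀ k, Stream (S k)) (A C : Finset (Fin K)) : ℝ :=
  lrSum A C fun k => driftSign A k * drift M A k

lemma tendsto_P_lt_lrSum (hKL : ∀ k, (M k).KLPosFinite) (A C : Finset (Fin K)) {c : ℝ}
    (hc : infoSum M A C < c) :
    Tendsto (fun n : ℕ => P M A {ω | c * n < lrSum A C (llr M ω n)}) atTop (𝓝 0) := by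
  have hae : ∀ᵐ ω ∂(P M A), Tendsto (fun n : ℕ => lrSum A C (llr M ω n) / n) atTop
      (𝓝 (infoSum M A C)) := by
    filter_upwards [ae_all_iff.2 fun k => ae_tendsto_llr_div hKL A k] with ω hω
    have := tendsto_finsetSum Finset.univ fun k _ => (hω k).const_mul (coeff A C k)
    refine this.congr fun n => ?_
    simp only [lrSum, Finset.sum_div, mul_div_assoc]
  have h2 := tendstoInMeasure_of_tendsto_ae (fun n =>
    (((measurable_lrSum A C).comp (measurable_llr M n)).div_const _).aestronglyMeasurable) hae
  have h3 := (tendstoInMeasure_iff_dist.1 h2) (c - infoSum M A C) (sub_pos.2 hc)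
  refine tendsto_of_tendsto_of_tendsto_of_le_of_le' tendsto_const_nhds h3
    (Eventually.of_forall fun n => zero_le) ?_
  filter_upwards [eventually_gt_atTop 0] with n hn
  refine measure_mono fun ω hω => ?_
  have hn' : (0 : ℝ) < n := by exact_mod_cast hn
  have hω' : c * n < lrSum A C (llr M ω n) := hω
  have := (lt_div_iff₀ hn').2 hω'
  simp only [Set.mem_ofPred_eq, Real.dist_eq, Function.comp_apply]
  exact le_trans (by linarith) (le_abs_self _)

/-! ### Order statistics -/

/-- The indices of the `m` largest entries of `x`, ties broken by the index. -/
noncomputable def topSet (x : Fin K → ℝ) (m : ℕ) : Finset (Fin K) :=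
  (Finset.univ.filter (fun i : Fin K => i.val < m)).image (orderIndex x)

lemma mem_topSet {x : Fin K → ℝ} {m : ℕ} {k : Fin K} :
    k ∈ topSet x m ↔ ((orderIndex x).symm k).val < m := by
  simp only [topSet, Finset.mem_image, Finset.mem_filter, Finset.mem_univ, true_and]
  constructor
  · rintro ⟨i, hi, rfl⟩
    simpa using hi
  · intro h
    exact ⟨_, h, by simp⟩

lemma card_topSet (x : Fin K → ℝ) {m : ℕ} (hm : m ≤ K) : (topSet x m).card = m := by
  rw [topSet, Finset.card_image_of_injective _ (orderIndex x).injective, Fin.card_filter_val_lt,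
    min_eq_right hm]

lemma apply_orderIndex_antitone (x : Fin K → ℝ) {i j : Fin K} (h : i ≤ j) :
    x (orderIndex x j) ≤ x (orderIndex x i) :=
  neg_le_neg_iff.1 (Tuple.monotone_sort (fun k => -x k) h)

lemma apply_orderIndex_le_of_mem_topSet {x : Fin K → ℝ} {m : ℕ} {k : Fin K} (hk : k ∈ topSet x m)
    {i : Fin K} (hi : m ≤ i.val + 1) : x (orderIndex x i) ≤ x k := by
  have h := apply_orderIndex_antitone x (i := (orderIndex x).symm k) (j := i)
    (by have := mem_topSet.1 hk; rw [Fin.le_def]; omega)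
  simpa using h

lemma le_apply_orderIndex_of_notMem_topSet {x : Fin K → ℝ} {m : ℕ} {k : Fin K}
    (hk : k ∉ topSet x m) {i : Fin K} (hi : i.val ≤ m) : x k ≤ x (orderIndex x i) := by
  have h := apply_orderIndex_antitone x (j := (orderIndex x).symm k) (i := i)
    (by rw [mem_topSet] at hk; rw [Fin.le_def]; omega)
  simpa using h

lemma le_of_mem_topSet_of_notMem {x : Fin K → ℝ} {m : ℕ} {i j : Fin K} (hi : i ∈ topSet x m)
    (hj : j ∉ topSet x m) : x j ≤ x i := by
  have h := le_apply_orderIndex_of_notMem_topSet hj (i := (orderIndex x).symm i)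
    (mem_topSet.1 hi).le
  simpa using h

lemma exists_mem_notMem_of_card_le {A B : Finset (Fin K)} {k : Fin K} (hk : k ∈ A) (hk' : k ∉ B)
    (h : A.card ≤ B.card) : ∃ j ∈ B, j ∉ A := by
  by_contra! hc
  exact hk' (Finset.eq_of_subset_of_card_le hc h ▸ hk)

lemma topSet_eq_of_forall_lt {x : Fin K → ℝ} {B : Finset (Fin K)}
    (h : ∀ i ∈ B, ∀ j ∉ B, x j < x i) : topSet x B.card = B := by
  have hc : (topSet x B.card).card = B.card := card_topSet x (by simpa using B.card_le_univ)
  refine Finset.eq_of_subset_of_card_le (fun i hi => ?_) hc.ge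
  by_contra hiB
  obtain ⟨j, hj, hj'⟩ := exists_mem_notMem_of_card_le hi hiB hc.le
  exact (h j hj i hiB).not_ge (le_of_mem_topSet_of_notMem hi hj')

lemma orderIndex_mem_iff {x : Fin K → ℝ} {B : Finset (Fin K)}
    (h : ∀ i ∈ B, ∀ j ∉ B, x j < x i) {i : Fin K} : orderIndex x i ∈ B ↔ i.val < B.card := by
  have := mem_topSet (x := x) (m := B.card) (k := orderIndex x i)
  rwa [topSet_eq_of_forall_lt h, Equiv.symm_apply_apply] at this

lemma orderStat_succ (x : Fin K → ℝ) {j : ℕ} (hj : j < K) :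
    orderStat x (j + 1) = ((x (orderIndex x ⟨j, hj⟩) : ℝ) : EReal) := by
  simp [orderStat, hj]

lemma orderStat_zero (x : Fin K → ℝ) : orderStat x 0 = ⊥ := by simp [orderStat]

lemma orderStat_of_lt (x : Fin K → ℝ) {j : ℕ} (hj : K < j) : orderStat x j = ⊤ := by
  have h0 : j ≠ 0 := by omega
  have h1 : ¬ j - 1 < K := by omega
  simp [orderStat, h0, h1]

/-- The set of vectors of log-likelihood ratios at which the gap-intersection rule stops by
`τ₁`. -/
def gapRegion₁ (K ℓ : ℕ) (a c : ℝ) : Set (Fin K → ℝ) :=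
  {x | orderStat x (ℓ + 1) ≤ ((-a : ℝ) : EReal) ∧
    (c : EReal) ≤ orderStat x ℓ - orderStat x (ℓ + 1)}

/-- The set of vectors of log-likelihood ratios at which the gap-intersection rule stops by
`τ₂`. -/
def intersectionRegion (K ℓ u : ℕ) (a b : ℝ) : Set (Fin K → ℝ) :=
  {x | (ℓ ≤ numPos x ∧ numPos x ≤ u) ∧ ∀ k, x k ∉ Set.Ioo (-a) b}

/-- The set of vectors of log-likelihood ratios at which the gap-intersection rule stops by
`τ₃`. -/
def gapRegion₃ (K u : ℕ) (b d : ℝ) : Set (Fin K → ℝ) :=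
  {x | (b : EReal) ≤ orderStat x u ∧ (d : EReal) ≤ orderStat x u - orderStat x (u + 1)}

lemma mem_gapRegion₁ {ℓ : ℕ} (hℓ : ℓ < K) {a c : ℝ} {x : Fin K → ℝ} :
    x ∈ gapRegion₁ K ℓ a c ↔ 0 < ℓ ∧ x (orderIndex x ⟨ℓ, hℓ⟩) ≤ -a ∧
      c ≤ x (orderIndex x ⟨ℓ - 1, by omega⟩) - x (orderIndex x ⟨ℓ, hℓ⟩) := by
  rw [gapRegion₁, Set.mem_ofPred_eq, orderStat_succ x hℓ]
  rcases Nat.eq_zero_or_pos ℓ with rfl | h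
  · simp [orderStat_zero]
  · obtain ⟨m, rfl⟩ : ∃ m, ℓ = m + 1 := ⟨ℓ - 1, by omega⟩
    rw [orderStat_succ x (by omega : m < K), ← EReal.coe_sub, EReal.coe_le_coe_iff,
      EReal.coe_le_coe_iff]
    simp

lemma mem_gapRegion₃ {u : ℕ} (hu : 0 < u) (huK : u ≤ K) {b d : ℝ} {x : Fin K → ℝ} :
    x ∈ gapRegion₃ K u b d ↔ ∃ h : u < K, b ≤ x (orderIndex x ⟨u - 1, by omega⟩) ∧
      d ≤ x (orderIndex x ⟨u - 1, by omega⟩) - x (orderIndex x ⟨u, h⟩) := by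
  obtain ⟨m, rfl⟩ : ∃ m, u = m + 1 := ⟨u - 1, by omega⟩
  rw [gapRegion₃, Set.mem_ofPred_eq, orderStat_succ x (by omega : m < K)]
  rcases huK.lt_or_eq with h | h
  · rw [orderStat_succ x h, ← EReal.coe_sub, EReal.coe_le_coe_iff,
      EReal.coe_le_coe_iff]
    simp [h]
  · rw [orderStat_of_lt x (by omega)]
    simp [h]

/-! ### The gap-intersection rule at a stopping point -/

/-- The set of vectors of log-likelihood ratios at which the gap-intersection rule stops. -/
def stopRegion (K ℓ u : ℕ) (a b c d : ℝ) : Set (Fin K → ℝ) :=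
  gapRegion₁ K ℓ a c ∪ (intersectionRegion K ℓ u a b ∪ gapRegion₃ K u b d)

/-- The decision of the gap-intersection rule as a function of the log-likelihood ratios. -/
noncomputable def decision (ℓ u : ℕ) (x : Fin K → ℝ) : Finset (Fin K) :=
  topSet x (min (max (numPos x) ℓ) u)

lemma numPos_le_card {x : Fin K → ℝ} {B : Finset (Fin K)} (h : ∀ k ∉ B, x k ≤ 0) :
    numPos x ≤ B.card := by
  refine Finset.card_le_card fun k hk => ?_
  by_contra hkB
  exact absurd (Finset.mem_filter.1 hk).2 (h k hkB).not_gt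

lemma card_le_numPos {x : Fin K → ℝ} {B : Finset (Fin K)} (h : ∀ k ∈ B, 0 < x k) :
    B.card ≤ numPos x :=
  Finset.card_le_card fun k hk => Finset.mem_filter.2 ⟨Finset.mem_univ k, h k hk⟩

/-- What stopping tells about the decision `decision ℓ u x`, for each of the three ways to stop. -/
lemma decision_of_mem_stopRegion {ℓ u : ℕ} (hℓu : ℓ < u) (huK : u ≤ K) {a b c d : ℝ} (ha : 0 < a)
    (hb : 0 < b) {x : Fin K → ℝ} (hx : x ∈ stopRegion K ℓ u a b c d) :
    ((decision ℓ u x).card = ℓ ∧ (∀ k ∉ decision ℓ u x, x k ≤ -a) ∧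
      ∀ i ∈ decision ℓ u x, ∀ j ∉ decision ℓ u x, c ≤ x i - x j) ∨
    ((∀ k ∈ decision ℓ u x, b ≤ x k) ∧ ∀ k ∉ decision ℓ u x, x k ≤ -a) ∨
    ((decision ℓ u x).card = u ∧ (∀ k ∈ decision ℓ u x, b ≤ x k) ∧
      ∀ i ∈ decision ℓ u x, ∀ j ∉ decision ℓ u x, d ≤ x i - x j) := by
  rcases hx with hx | hx | hx
  · left
    obtain ⟨h0, h1, h2⟩ := (mem_gapRegion₁ (hℓu.trans_le huK)).1 hx
    have hlow : ∀ k ∉ topSet x ℓ, x k ≤ -a := fun k hk =>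
      (le_apply_orderIndex_of_notMem_topSet hk (i := ⟨ℓ, _⟩) le_rfl).trans h1
    have hcard := card_topSet x (hℓu.le.trans huK)
    have hn : numPos x ≤ ℓ := by
      rw [← hcard]
      exact numPos_le_card fun k hk => (hlow k hk).trans (by linarith)
    have hD : decision ℓ u x = topSet x ℓ := by
      rw [decision, max_eq_right hn, min_eq_left hℓu.le]
    rw [hD]
    refine ⟨hcard, hlow, fun i hi j hj => h2.trans ?_⟩
    exact sub_le_sub (apply_orderIndex_le_of_mem_topSet hi (by simp; omega))
      (le_apply_orderIndex_of_notMem_topSet hj (i := ⟨ℓ, _⟩) le_rfl)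
  · right; left
    obtain ⟨⟨h0, h1⟩, h2⟩ := hx
    have hD : decision ℓ u x = Finset.univ.filter fun k => 0 < x k := by
      rw [decision, max_eq_left h0, min_eq_left h1]
      refine topSet_eq_of_forall_lt fun i hi j hj => ?_
      simp only [Finset.mem_filter, Finset.mem_univ, true_and] at hi hj
      linarith
    rw [hD]
    simp only [Finset.mem_filter, Finset.mem_univ, true_and, not_lt]
    refine ⟨fun k hk => ?_, fun k hk => ?_⟩
    · by_contra! hlt
      exact h2 k ⟨by linarith, hlt⟩
    · by_contra! hlt
      exact h2 k ⟨hlt, by linarith⟩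
  · right; right
    obtain ⟨hK, h1, h2⟩ := (mem_gapRegion₃ (by omega) huK).1 hx
    have hhigh : ∀ k ∈ topSet x u, b ≤ x k := fun k hk =>
      h1.trans (apply_orderIndex_le_of_mem_topSet hk (by simp; omega))
    have hcard := card_topSet x huK
    have hn : u ≤ numPos x := by
      conv_lhs => rw [← hcard]
      exact card_le_numPos fun k hk => hb.trans_le (hhigh k hk)
    have hD : decision ℓ u x = topSet x u := by
      rw [decision, min_eq_right (hn.trans (le_max_left _ _))]
    rw [hD]
    refine ⟨hcard, hhigh, fun i hi j hj => h2.trans ?_⟩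
    exact sub_le_sub (apply_orderIndex_le_of_mem_topSet hi (by simp; omega))
      (le_apply_orderIndex_of_notMem_topSet hj (i := ⟨u, _⟩) le_rfl)

lemma exists_of_false_positive {ℓ u : ℕ} (hℓu : ℓ < u) (huK : u ≤ K) {a b c d : ℝ} (ha : 0 < a)
    (hb : 0 < b) {x : Fin K → ℝ} (hx : x ∈ stopRegion K ℓ u a b c d) {A : Finset (Fin K)}
    (hA : ℓ ≤ A.card) (h : (decision ℓ u x \ A).Nonempty) :
    (∃ j ∉ A, b ≤ x j) ∨ ∃ j ∉ A, ∃ i ∈ A, c ≤ x j - x i := by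
  obtain ⟨j, hj⟩ := h
  obtain ⟨hjD, hjA⟩ := Finset.mem_sdiff.1 hj
  rcases decision_of_mem_stopRegion hℓu huK ha hb hx with ⟨h1, -, h3⟩ | ⟨h1, -⟩ | ⟨-, h1, -⟩
  · obtain ⟨i, hi, hi'⟩ := exists_mem_notMem_of_card_le hjD hjA (h1.trans_le hA)
    exact Or.inr ⟨j, hjA, i, hi, h3 j hjD i hi'⟩
  · exact Or.inl ⟨j, hjA, h1 j hjD⟩
  · exact Or.inl ⟨j, hjA, h1 j hjD⟩

lemma exists_of_false_negative {ℓ u : ℕ} (hℓu : ℓ < u) (huK : u ≤ K) {a b c d : ℝ} (ha : 0 < a)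
    (hb : 0 < b) {x : Fin K → ℝ} (hx : x ∈ stopRegion K ℓ u a b c d) {A : Finset (Fin K)}
    (hA : A.card ≤ u) (h : (A \ decision ℓ u x).Nonempty) :
    (∃ i ∈ A, x i ≤ -a) ∨ ∃ j ∉ A, ∃ i ∈ A, d ≤ x j - x i := by
  obtain ⟨i, hi⟩ := h
  obtain ⟨hiA, hiD⟩ := Finset.mem_sdiff.1 hi
  rcases decision_of_mem_stopRegion hℓu huK ha hb hx with ⟨-, h1, -⟩ | ⟨-, h1⟩ | ⟨h1, -, h3⟩
  · exact Or.inl ⟨i, hiA, h1 i hiD⟩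
  · exact Or.inl ⟨i, hiA, h1 i hiD⟩
  · obtain ⟨j, hj, hj'⟩ := exists_mem_notMem_of_card_le hiA hiD (hA.trans_eq h1.symm)
    exact Or.inr ⟨j, hj', i, hiA, h3 j hj i hiD⟩

lemma mem_gapRegion₁_of_forall {A : Finset (Fin K)} (h0 : 0 < A.card) (hK : A.card < K) {a c : ℝ}
    {x : Fin K → ℝ} (hlow : ∀ k ∉ A, x k ≤ -a) (hgap : ∀ i ∈ A, ∀ j ∉ A, c ≤ x i - x j)
    (hlt : ∀ i ∈ A, ∀ j ∉ A, x j < x i) : x ∈ gapRegion₁ K A.card a c := by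
  have h1 : orderIndex x ⟨A.card - 1, by omega⟩ ∈ A :=
    (orderIndex_mem_iff hlt).2 (Nat.sub_lt h0 one_pos)
  have h2 : orderIndex x ⟨A.card, hK⟩ ∉ A := fun h => lt_irrefl _ ((orderIndex_mem_iff hlt).1 h)
  exact (mem_gapRegion₁ hK).2 ⟨h0, hlow _ h2, hgap _ h1 _ h2⟩

lemma mem_gapRegion₃_of_forall {A : Finset (Fin K)} (h0 : 0 < A.card) (hK : A.card < K) {b d : ℝ}
    {x : Fin K → ℝ} (hhigh : ∀ k ∈ A, b ≤ x k) (hgap : ∀ i ∈ A, ∀ j ∉ A, d ≤ x i - x j)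
    (hlt : ∀ i ∈ A, ∀ j ∉ A, x j < x i) : x ∈ gapRegion₃ K A.card b d := by
  have h1 : orderIndex x ⟨A.card - 1, by omega⟩ ∈ A :=
    (orderIndex_mem_iff hlt).2 (Nat.sub_lt h0 one_pos)
  have h2 : orderIndex x ⟨A.card, hK⟩ ∉ A := fun h => lt_irrefl _ ((orderIndex_mem_iff hlt).1 h)
  exact (mem_gapRegion₃ h0 hK.le).2 ⟨hK, hhigh _ h1, hgap _ h1 _ h2⟩

lemma mem_intersectionRegion_of_forall {ℓ u : ℕ} {A : Finset (Fin K)} (hℓ : ℓ ≤ A.card)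
    (hu : A.card ≤ u) {a b : ℝ} (ha : 0 < a) (hb : 0 < b) {x : Fin K → ℝ}
    (hhigh : ∀ k ∈ A, b ≤ x k) (hlow : ∀ k ∉ A, x k ≤ -a) :
    x ∈ intersectionRegion K ℓ u a b := by
  have hn : numPos x = A.card := le_antisymm
    (numPos_le_card fun k hk => (hlow k hk).trans (by linarith))
    (card_le_numPos fun k hk => hb.trans_le (hhigh k hk))
  refine ⟨by omega, fun k hk => ?_⟩
  by_cases hkA : k ∈ A
  · exact (hhigh k hkA).not_gt hk.2
  · exact (hlow k hkA).not_gt hk.1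

/-! ### The gap-intersection rule is a sequential test -/

lemma firstTime_le_iff {Q : ℕ → Prop} {n : ℕ} :
    firstTime Q ≤ n ↔ ∃ m ≤ n, 1 ≤ m ∧ Q m := by
  constructor
  · intro h
    by_contra! hc
    have : ((n + 1 : ℕ) : ℕ∞) ≤ firstTime Q := le_iInf₂ fun m hm => by
      by_contra! hlt
      exact hc m (Nat.lt_succ_iff.1 (by exact_mod_cast hlt)) hm.1 hm.2
    have h2 := this.trans h
    have : n + 1 ≤ n := by exact_mod_cast h2
    omega
  · rintro ⟨m, hm, h1, hQ⟩
    exact (iInf₂_le m ⟨h1, hQ⟩).trans (by exact_mod_cast hm)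

lemma of_firstTime_eq {Q : ℕ → Prop} {n : ℕ} (h : firstTime Q = n) : Q n := by
  obtain ⟨m, hm, h1, hQ⟩ := firstTime_le_iff.1 h.le
  have : firstTime Q ≤ m := firstTime_le_iff.2 ⟨m, le_rfl, h1, hQ⟩
  rw [h] at this
  have : n ≤ m := by exact_mod_cast this
  rwa [le_antisymm this hm]

lemma one_le_firstTime (Q : ℕ → Prop) : 1 ≤ firstTime Q :=
  le_iInf₂ fun n hn => by exact_mod_cast hn.1

lemma firstTime_or (Q R : ℕ → Prop) :
    firstTime (fun n => Q n ∨ R n) = min (firstTime Q) (firstTime R) := by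
  refine eq_of_forall_le_iff fun t => ?_
  simp only [firstTime, le_inf_iff, le_iInf_iff]
  constructor
  · exact fun h => ⟨fun n hn => h n ⟨hn.1, Or.inl hn.2⟩, fun n hn => h n ⟨hn.1, Or.inr hn.2⟩⟩
  · rintro ⟨h1, h2⟩ n ⟨hn, h | h⟩
    exacts [h1 n ⟨hn, h⟩, h2 n ⟨hn, h⟩]

lemma gapIntersectionTime_eq (M : ∀ k, Stream (S k)) (ℓ u : ℕ) (a b c d : ℝ) (ω : Path S) :
    gapIntersectionTime M ℓ u a b c d ω =
      firstTime fun n => llr M ω n ∈ stopRegion K ℓ u a b c d := by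
  rw [gapIntersectionTime, tau₁, tau₂, tau₃, ← firstTime_or, ← firstTime_or]
  rfl

/-- For fixed `σ`, the condition `orderIndex x = σ` is given by finitely many inequalities between
the entries of `x`. -/
lemma measurableSet_orderIndex_eq (σ : Equiv.Perm (Fin K)) :
    MeasurableSet {x : Fin K → ℝ | orderIndex x = σ} := by
  have : {x : Fin K → ℝ | orderIndex x = σ} =
      {x | (∀ i j, i ≤ j → x (σ j) ≤ x (σ i)) ∧
        ∀ i j, i < j → x (σ i) = x (σ j) → σ i < σ j} := by
    ext x
    simp only [Set.mem_ofPred_eq, orderIndex]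
    rw [eq_comm, Tuple.eq_sort_iff]
    simp [Monotone]
  rw [this]
  measurability

lemma measurableSet_orderIndex {p : Equiv.Perm (Fin K) → (Fin K → ℝ) → Prop}
    (hp : ∀ σ, MeasurableSet {x | p σ x}) : MeasurableSet {x | p (orderIndex x) x} := by
  have : {x | p (orderIndex x) x} = ⋃ σ, ({x | orderIndex x = σ} ∩ {x | p σ x}) := by
    ext x; simp
  rw [this]
  exact MeasurableSet.iUnion fun σ => (measurableSet_orderIndex_eq σ).inter (hp σ)

lemma measurable_numPos : Measurable (numPos : (Fin K → ℝ) → ℕ) := by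
  have : (numPos : (Fin K → ℝ) → ℕ) = fun x => ∑ k, if 0 < x k then 1 else 0 := by
    funext x; rw [numPos, Finset.card_filter]
  rw [this]
  refine Finset.measurable_fun_sum _ fun k _ => Measurable.ite ?_ measurable_const measurable_const
  exact measurableSet_lt measurable_const (measurable_pi_apply k)

lemma measurableSet_mem_decision (ℓ u : ℕ) (k : Fin K) :
    MeasurableSet {x : Fin K → ℝ | k ∈ decision ℓ u x} := by
  simp only [decision, mem_topSet]
  refine measurableSet_orderIndex (p := fun σ x => (σ.symm k).val < min (max (numPos x) ℓ) u)
    fun σ => ?_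
  exact measurableSet_lt measurable_const
    ((measurable_numPos.max measurable_const).min measurable_const)

lemma measurableSet_le_sub (c : ℝ) (i j : Fin K) :
    MeasurableSet {x : Fin K → ℝ | c ≤ x i - x j} :=
  measurableSet_le measurable_const (by fun_prop)

lemma measurableSet_stopRegion {ℓ u : ℕ} (hℓu : ℓ < u) (huK : u ≤ K) (a b c d : ℝ) :
    MeasurableSet (stopRegion K ℓ u a b c d) := by
  refine MeasurableSet.union ?_ (MeasurableSet.union ?_ ?_)
  · have : gapRegion₁ K ℓ a c = {x | 0 < ℓ ∧ x (orderIndex x ⟨ℓ, hℓu.trans_le huK⟩) ≤ -a ∧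
        c ≤ x (orderIndex x ⟨ℓ - 1, by omega⟩) - x (orderIndex x ⟨ℓ, hℓu.trans_le huK⟩)} := by
      ext x; exact mem_gapRegion₁ _
    rw [this]
    refine measurableSet_orderIndex (p := fun σ x => 0 < ℓ ∧ x (σ ⟨ℓ, hℓu.trans_le huK⟩) ≤ -a ∧
        c ≤ x (σ ⟨ℓ - 1, by omega⟩) - x (σ ⟨ℓ, hℓu.trans_le huK⟩)) fun σ => ?_
    exact (MeasurableSet.const _).inter
      ((measurableSet_le (measurable_pi_apply _) measurable_const).inter
        (measurableSet_le_sub _ _ _))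
  · refine MeasurableSet.inter (MeasurableSet.inter ?_ ?_) ?_
    · exact measurableSet_le measurable_const measurable_numPos
    · exact measurableSet_le measurable_numPos measurable_const
    · have : {x : Fin K → ℝ | ∀ k, x k ∉ Set.Ioo (-a) b} =
          ⋂ k, (fun x : Fin K → ℝ => x k) ⁻¹' (Set.Ioo (-a) b)ᶜ := by ext; simp
      change MeasurableSet {x : Fin K → ℝ | ∀ k, x k ∉ Set.Ioo (-a) b}
      rw [this]
      exact MeasurableSet.iInter fun k => measurable_pi_apply k measurableSet_Ioo.compl
  · rcases huK.lt_or_eq with h | h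
    · have : gapRegion₃ K u b d = {x | b ≤ x (orderIndex x ⟨u - 1, by omega⟩) ∧
          d ≤ x (orderIndex x ⟨u - 1, by omega⟩) - x (orderIndex x ⟨u, h⟩)} := by
        ext x; rw [mem_gapRegion₃ (by omega) huK]; simp [h]
      rw [this]
      refine measurableSet_orderIndex (p := fun σ x => b ≤ x (σ ⟨u - 1, by omega⟩) ∧
          d ≤ x (σ ⟨u - 1, by omega⟩) - x (σ ⟨u, h⟩)) fun σ => ?_
      exact (measurableSet_le measurable_const (measurable_pi_apply _)).inter
        (measurableSet_le_sub _ _ _)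
    · have : gapRegion₃ K u b d = ∅ := by
        ext x; rw [mem_gapRegion₃ (by omega) huK]; simp [h]
      rw [this]
      exact MeasurableSet.empty

/-- Stopping at the first visit of the log-likelihood ratios to a measurable set `G`, with a
decision that is a measurable function `δ` of the log-likelihood ratios at that time, is a
sequential test. On `T = ∞`, where `toNat` is `0`, the decision is `δ 0`. -/
lemma isSequentialTest_firstTime (M : ∀ k, Stream (S k)) {G : Set (Fin K → ℝ)}
    (hG : MeasurableSet G) {δ : (Fin K → ℝ) → Finset (Fin K)}
    (hδ : ∀ k, MeasurableSet {x | k ∈ δ x}) :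
    IsSequentialTest (fun ω : Path S => firstTime fun n => llr M ω n ∈ G)
      (fun ω => δ (llr M ω (firstTime fun n => llr M ω n ∈ G).toNat)) := by
  refine ⟨fun ω => one_le_firstTime _, ?_⟩
  set T : Path S → ℕ∞ := fun ω => firstTime fun n => llr M ω n ∈ G with hTdef
  have hT : IsStoppingTime (ℱ S) T := by
    intro n
    have : {ω | T ω ≤ (n : ℕ∞)} = ⋃ m ∈ Set.Icc 1 n, {ω | llr M ω m ∈ G} := by
      ext ω
      simp only [hTdef, Set.mem_ofPred_eq, firstTime_le_iff, Set.mem_iUnion, Set.mem_Icc,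
        exists_prop]
      exact ⟨fun ⟨m, h1, h2, h3⟩ => ⟨m, ⟨h2, h1⟩, h3⟩, fun ⟨m, ⟨h2, h1⟩, h3⟩ => ⟨m, h1, h2, h3⟩⟩
    change MeasurableSet[ℱ S n] {ω | T ω ≤ (n : ℕ∞)}
    rw [this]
    refine @MeasurableSet.biUnion _ _ (ℱ S n) _ _ (Set.to_countable _) fun m hm => ?_
    exact (ℱ S).mono hm.2 _ (measurable_llr_ℱ M m hG)
  refine ⟨hT, fun k => ?_⟩
  have hn : ∀ n : ℕ, MeasurableSet[ℱ S n] ({ω | k ∈ δ (llr M ω (T ω).toNat)} ∩ {ω | T ω = n}) := by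
    intro n
    have : {ω | k ∈ δ (llr M ω (T ω).toNat)} ∩ {ω | T ω = n} =
        {ω | k ∈ δ (llr M ω n)} ∩ {ω | T ω = n} := by
      ext ω
      simp only [Set.mem_inter_iff, Set.mem_ofPred_eq, and_congr_left_iff]
      intro h; rw [h]; simp
    rw [this]
    exact @MeasurableSet.inter _ (ℱ S n) _ _ (measurable_llr_ℱ M n (hδ k)) (hT.measurableSet_eq n)
  have htop : {ω | k ∈ δ (llr M ω (T ω).toNat)} ∩ {ω | T ω = ⊤} =
      {ω | T ω = ⊤} ∩ {_ω | k ∈ δ 0} := by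
    ext ω
    have h0 : llr M ω 0 = 0 := by funext k; simp [llr]
    simp only [Set.mem_inter_iff, Set.mem_ofPred_eq]
    constructor
    · rintro ⟨h1, h2⟩; rw [h2] at h1; simp only [ENat.toNat_top, h0] at h1; exact ⟨h2, h1⟩
    · rintro ⟨h1, h2⟩; refine ⟨?_, h1⟩; rw [h1]; simpa only [ENat.toNat_top, h0] using h2
  refine (hT.measurableSet _).2 ⟨?_, fun n => ?_⟩
  · have : {ω | k ∈ δ (llr M ω (T ω).toNat)} =
        ({ω | k ∈ δ (llr M ω (T ω).toNat)} ∩ {ω | T ω = ⊤}) ∪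
          ⋃ n : ℕ, ({ω | k ∈ δ (llr M ω (T ω).toNat)} ∩ {ω | T ω = n}) := by
      rw [← Set.inter_iUnion, ← Set.inter_union_distrib_left, Set.left_eq_inter]
      intro ω _
      rcases eq_or_ne (T ω) ⊤ with h | h
      · exact Or.inl h
      · exact Or.inr (Set.mem_iUnion.2 ⟨(T ω).toNat, (ENat.natCast_toNat h).symm⟩)
    rw [this]
    have hle : ∀ n, (ℱ S n : MeasurableSpace (Path S)) ≤ ⨆ t, ℱ S t := fun n => le_iSup _ n
    have hTtop : {ω | T ω = ⊤} = (⋃ n : ℕ, {ω | T ω = n})ᶜ := by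
      ext ω
      simp only [Set.mem_ofPred_eq, Set.mem_compl_iff, Set.mem_iUnion, not_exists]
      exact ⟨fun h n => by simp [h], fun h => by
        by_contra hne; exact h (T ω).toNat (ENat.natCast_toNat hne).symm⟩
    refine @MeasurableSet.union _ (⨆ t, ℱ S t) _ _ ?_
      (@MeasurableSet.iUnion _ _ (⨆ t, ℱ S t) _ _ fun n => hle n _ (hn n))
    rw [htop, hTtop]
    refine @MeasurableSet.inter _ (⨆ t, ℱ S t) _ _ (@MeasurableSet.compl _ _ (⨆ t, ℱ S t) ?_)
      (@MeasurableSet.const _ (⨆ t, ℱ S t) _)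
    exact @MeasurableSet.iUnion _ _ (⨆ t, ℱ S t) _ _ fun n => hle n _ (hT.measurableSet_eq n)
  · have : {ω | k ∈ δ (llr M ω (T ω).toNat)} ∩ {ω | T ω ≤ (n : ℕ∞)} =
        ⋃ m ∈ Set.Iic n, ({ω | k ∈ δ (llr M ω (T ω).toNat)} ∩ {ω | T ω = m}) := by
      ext ω
      simp only [Set.mem_inter_iff, Set.mem_ofPred_eq, Set.mem_iUnion, Set.mem_Iic, exists_prop]
      constructor
      · rintro ⟨h1, h2⟩
        have hne : T ω ≠ ⊤ := ne_top_of_le_ne_top (ENat.natCast_ne_top n) h2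
        refine ⟨(T ω).toNat, ?_, h1, (ENat.natCast_toNat hne).symm⟩
        exact ENat.toNat_le_of_le_natCast h2
      · rintro ⟨m, hm, h1, h2⟩
        exact ⟨h1, by rw [h2]; exact_mod_cast hm⟩
    change MeasurableSet[ℱ S n] ({ω | k ∈ δ (llr M ω (T ω).toNat)} ∩ {ω | T ω ≤ (n : ℕ∞)})
    rw [this]
    exact @MeasurableSet.biUnion _ _ (ℱ S n) _ _ (Set.to_countable _)
      fun m hm => (ℱ S).mono hm _ (hn m)

lemma isSequentialTest_gapIntersection (M : ∀ k, Stream (S k)) {ℓ u : ℕ} (hℓu : ℓ < u)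
    (huK : u ≤ K) (a b c d : ℝ) :
    IsSequentialTest (gapIntersectionTime M ℓ u a b c d)
      (gapIntersectionDecision M ℓ u a b c d) := by
  have h := isSequentialTest_firstTime M (measurableSet_stopRegion hℓu huK a b c d)
    (δ := decision ℓ u) (measurableSet_mem_decision ℓ u)
  have h1 : gapIntersectionTime M ℓ u a b c d =
      fun ω => firstTime fun n => llr M ω n ∈ stopRegion K ℓ u a b c d :=
    funext (gapIntersectionTime_eq M ℓ u a b c d)
  have h2 : gapIntersectionDecision M ℓ u a b c d =
      fun ω => decision ℓ u (llr M ω (gapIntersectionTime M ℓ u a b c d ω).toNat) := rfl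
  rw [h2, h1]
  exact h

/-! ### Neighbouring hypotheses -/

lemma lrSum_self (A : Finset (Fin K)) (x : Fin K → ℝ) : lrSum A A x = 0 := by
  simp [lrSum, coeff]

lemma lrSum_insert {A C : Finset (Fin K)} {j : Fin K} (hj : j ∉ C) (x : Fin K → ℝ) :
    lrSum A (insert j C) x = lrSum A C x - x j := by
  have h : ∀ k, coeff A (insert j C) k * x k = coeff A C k * x k - if k = j then x k else 0 := by
    intro k
    by_cases hk : k = j
    · subst hk; simp [coeff, hj, sub_mul]
    · simp [coeff, hk]
  simp [lrSum, h]

lemma lrSum_erase {A C : Finset (Fin K)} {i : Fin K} (hi : i ∈ C) (x : Fin K → ℝ) :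
    lrSum A (C.erase i) x = lrSum A C x + x i := by
  have h := lrSum_insert (A := A) (Finset.notMem_erase i C) x
  rw [Finset.insert_erase hi] at h
  linarith

lemma lrSum_swap {A : Finset (Fin K)} {i j : Fin K} (hi : i ∈ A) (hj : j ∉ A) (x : Fin K → ℝ) :
    lrSum A (insert j (A.erase i)) x = x i - x j := by
  rw [lrSum_insert (fun h => hj (Finset.mem_of_mem_erase h)), lrSum_erase hi, lrSum_self, zero_add]

/-! ### The explicit first-order value -/

lemma η₀_le (M : ∀ k, Stream (S k)) {A : Finset (Fin K)} {k : Fin K} (hk : k ∉ A) :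
    η₀ M A ≤ ENNReal.ofReal (M k).D₀ := iInf₂_le k hk

lemma η₁_le (M : ∀ k, Stream (S k)) {A : Finset (Fin K)} {k : Fin K} (hk : k ∈ A) :
    η₁ M A ≤ ENNReal.ofReal (M k).D₁ := iInf₂_le k hk

lemma exists_η₁_eq (M : ∀ k, Stream (S k)) {A : Finset (Fin K)} (hA : A.Nonempty) :
    ∃ k ∈ A, η₁ M A = ENNReal.ofReal (M k).D₁ := by
  obtain ⟨k, hk, hmin⟩ := A.exists_min_image (fun k => (M k).D₁) hA
  exact ⟨k, hk, le_antisymm (η₁_le M hk)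
    (le_iInf₂ fun j hj => ENNReal.ofReal_le_ofReal (hmin j hj))⟩

lemma exists_η₀_eq (M : ∀ k, Stream (S k)) {A : Finset (Fin K)} (hA : A.card < K) :
    ∃ k ∉ A, η₀ M A = ENNReal.ofReal (M k).D₀ := by
  have hne : Aᶜ.Nonempty := by
    rw [← Finset.card_pos, Finset.card_compl, Fintype.card_fin]; omega
  obtain ⟨k, hk, hmin⟩ := Aᶜ.exists_min_image (fun k => (M k).D₀) hne
  rw [Finset.mem_compl] at hk
  exact ⟨k, hk, le_antisymm (η₀_le M hk)
    (le_iInf₂ fun j hj => ENNReal.ofReal_le_ofReal (hmin j (Finset.mem_compl.2 hj)))⟩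

lemma η₁_ne_zero (hKL : ∀ k, (M k).KLPosFinite) (A : Finset (Fin K)) : η₁ M A ≠ 0 := by
  rcases A.eq_empty_or_nonempty with rfl | h
  · simp [η₁]
  · obtain ⟨k, -, h⟩ := exists_η₁_eq M h
    rw [h]
    exact (ENNReal.ofReal_pos.2 (hKL k).2.2.2).ne'

lemma η₀_ne_zero (hKL : ∀ k, (M k).KLPosFinite) (A : Finset (Fin K)) : η₀ M A ≠ 0 := by
  rcases (A.card_le_univ.trans_eq (Fintype.card_fin K)).lt_or_eq with h | h
  · obtain ⟨k, -, h⟩ := exists_η₀_eq M h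
    rw [h]
    exact (ENNReal.ofReal_pos.2 (hKL k).2.2.1).ne'
  · have : A = Finset.univ := Finset.eq_univ_of_card A (by simpa using h)
    subst this
    simp [η₀]

lemma firstOrder_ne_top (hKL : ∀ k, (M k).KLPosFinite) (ℓ u : ℕ) (A : Finset (Fin K))
    (α β : ℝ) : firstOrder M ℓ u A α β ≠ ∞ := by
  have key : ∀ (x : ℝ) {η : ℝ≥0∞}, η ≠ 0 → absLog x / η ≠ ∞ := fun x η h =>
    ENNReal.div_ne_top ENNReal.ofReal_ne_top h
  have h0 := η₀_ne_zero hKL A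
  have h1 := η₁_ne_zero hKL A
  have h01 : η₀ M A + η₁ M A ≠ 0 := by simp [h0]
  have hmax : ∀ {x y : ℝ≥0∞}, x ≠ ∞ → y ≠ ∞ → max x y ≠ ∞ := fun hx hy =>
    (max_lt hx.lt_top hy.lt_top).ne
  unfold firstOrder
  split_ifs
  exacts [hmax (key _ h0) (key _ h01), hmax (key _ h0) (key _ h1), hmax (key _ h1) (key _ h01)]

lemma abs_log_le_mul_of_div_le {x D F : ℝ} {η : ℝ≥0∞} (hη : η ≤ ENNReal.ofReal D) (hD : 0 < D)
    (hF : 0 ≤ F) (h : absLog x / η ≤ ENNReal.ofReal F) : |Real.log x| ≤ F * D := by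
  have h1 : absLog x / ENNReal.ofReal D ≤ ENNReal.ofReal F :=
    (ENNReal.div_le_div_left hη _).trans h
  rw [ENNReal.div_le_iff (ENNReal.ofReal_pos.2 hD).ne' ENNReal.ofReal_ne_top,
    ← ENNReal.ofReal_mul hF] at h1
  exact (ENNReal.ofReal_le_ofReal_iff (by positivity)).1 h1

/-! ### Upper bound for the expected sample size of the gap-intersection rule -/

lemma mem_stopRegion_of_driftsFast {ℓ u : ℕ} (hℓu : ℓ < u) (huK : u ≤ K) {A : Finset (Fin K)}
    (hA : A ∈ sizeClass K ℓ u) {a b c d : ℝ} (ha : 0 < a) (hb : 0 < b)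
    (hKL : ∀ k, (M k).KLPosFinite) {r : ℝ} (hr : 0 < r) {n : ℕ} {ω : Path S}
    (hω : DriftsFast M A r n ω)
    (h₀ : A.card < u → ∀ k ∉ A, a ≤ r * n * (M k).D₀)
    (h₁ : ℓ < A.card → ∀ k ∈ A, b ≤ r * n * (M k).D₁)
    (hc : A.card = ℓ → ∀ i ∈ A, ∀ j ∉ A, c ≤ r * n * ((M j).D₀ + (M i).D₁))
    (hd : A.card = u → ∀ i ∈ A, ∀ j ∉ A, d ≤ r * n * ((M j).D₀ + (M i).D₁)) :
    llr M ω n ∈ stopRegion K ℓ u a b c d := by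
  obtain ⟨hA1, hA2⟩ := hA
  have hup : ∀ k ∈ A, r * n * (M k).D₁ < llr M ω n k := fun k hk => by
    have := hω k
    simp only [drift, driftSign, hk, if_true, one_mul] at this
    linarith
  have hdown : ∀ k ∉ A, llr M ω n k < -(r * n * (M k).D₀) := fun k hk => by
    have := hω k
    simp only [drift, driftSign, hk, if_false] at this
    linarith
  have hlt : ∀ i ∈ A, ∀ j ∉ A, llr M ω n j < llr M ω n i := fun i hi j hj => by
    have h1 := hup i hi
    have h2 := hdown j hj
    have h3 : 0 ≤ r * n * (M i).D₁ := mul_nonneg (by positivity) (hKL i).2.2.2.le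
    have h4 : 0 ≤ r * n * (M j).D₀ := mul_nonneg (by positivity) (hKL j).2.2.1.le
    linarith
  rcases hA1.eq_or_lt with h | h
  · have hlow : ∀ k ∉ A, llr M ω n k ≤ -a := fun k hk => by
      linarith [hdown k hk, h₀ (by omega) k hk]
    rcases Nat.eq_zero_or_pos ℓ with h0 | h0
    -- for `ℓ = 0` the gap conditions are void, and the rule stops by `τ₂`
    · have hAe : A = ∅ := Finset.card_eq_zero.1 (by omega)
      exact Or.inr (Or.inl (mem_intersectionRegion_of_forall hA1 hA2 ha hb
        (by simp [hAe]) hlow))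
    · left
      subst h
      refine mem_gapRegion₁_of_forall h0 (by omega) hlow (fun i hi j hj => ?_) hlt
      linarith [hc rfl i hi j hj, hup i hi, hdown j hj]
  · have hhigh : ∀ k ∈ A, b ≤ llr M ω n k := fun k hk => by
      linarith [hup k hk, h₁ h k hk]
    rcases hA2.lt_or_eq with h' | h'
    · exact Or.inr (Or.inl (mem_intersectionRegion_of_forall hA1 hA2 ha hb hhigh fun k hk => by
        linarith [hdown k hk, h₀ h' k hk]))
    · rcases huK.lt_or_eq with hK | hK
      · right; right
        subst h'
        refine mem_gapRegion₃_of_forall (by omega) hK hhigh (fun i hi j hj => ?_) hlt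
        linarith [hd rfl i hi j hj, hup i hi, hdown j hj]
      -- for `u = K` the gap conditions are void, and the rule stops by `τ₂`
      · have hAe : A = Finset.univ := Finset.eq_univ_of_card A (by simp; omega)
        exact Or.inr (Or.inl (mem_intersectionRegion_of_forall hA1 hA2 ha hb hhigh
          (by simp [hAe])))

lemma abs_log_pos {x : ℝ} (hx : x ∈ Set.Ioo (0 : ℝ) 1) : 0 < |Real.log x| :=
  abs_pos.2 (Real.log_neg hx.1 hx.2).ne

lemma threshold_pos (hK : 1 ≤ K) {x : ℝ} (hx : x ∈ Set.Ioo (0 : ℝ) 1) :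
    0 < |Real.log x| + Real.log K :=
  add_pos_of_pos_of_nonneg (abs_log_pos hx) (Real.log_nonneg (by exact_mod_cast hK))

/-- Up to a factor arbitrarily close to one and an additive constant, the gap-intersection rule
attains the explicit first-order value. -/
theorem exists_expectedTime_T_GI_le (hKL : ∀ k, (M k).KLPosFinite) {ℓ u : ℕ} (hℓu : ℓ < u)
    (huK : u ≤ K) {A : Finset (Fin K)} (hA : A ∈ sizeClass K ℓ u) {r : ℝ} (hr : 0 < r)
    (hr1 : r < 1) : ∃ C : ℝ, ∀ α ∈ Set.Ioo (0 : ℝ) 1, ∀ β ∈ Set.Ioo (0 : ℝ) 1,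
      expectedTime M A (T_GI M ℓ u α β) ≤
        ENNReal.ofReal ((firstOrder M ℓ u A α β).toReal / r + C) := by
  obtain ⟨C, hC⟩ := exists_expectedTime_le hKL A hr1
  have hK1 : 1 ≤ K := by omega
  have hKpos : (0 : ℝ) < K := by exact_mod_cast hK1
  have hlogK : 0 ≤ Real.log K := Real.log_nonneg (by exact_mod_cast hK1)
  -- a multiple `C₀` of every information number that exceeds the constants in the thresholds
  obtain ⟨C₀, hC₀, hC₀0, hC₀1⟩ : ∃ C₀ : ℝ, 0 ≤ C₀ ∧ (∀ k, Real.log K ≤ C₀ * (M k).D₀) ∧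
      ∀ k, Real.log K ≤ C₀ * (M k).D₁ := by
    have hn : ∀ k, 0 ≤ Real.log K / (M k).D₀ + Real.log K / (M k).D₁ := fun k =>
      add_nonneg (div_nonneg hlogK (hKL k).2.2.1.le) (div_nonneg hlogK (hKL k).2.2.2.le)
    refine ⟨∑ k, (Real.log K / (M k).D₀ + Real.log K / (M k).D₁),
      Finset.sum_nonneg fun k _ => hn k, fun k => ?_, fun k => ?_⟩
    · rw [← div_le_iff₀ (hKL k).2.2.1]
      have := Finset.single_le_sum (fun k _ => hn k) (Finset.mem_univ k)
      linarith [div_nonneg hlogK (hKL k).2.2.2.le]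
    · rw [← div_le_iff₀ (hKL k).2.2.2]
      have := Finset.single_le_sum (fun k _ => hn k) (Finset.mem_univ k)
      linarith [div_nonneg hlogK (hKL k).2.2.1.le]
  refine ⟨C₀ / r + 2 + C, fun α hα β hβ => ?_⟩
  set F := (firstOrder M ℓ u A α β).toReal with hFdef
  have hF0 : 0 ≤ F := ENNReal.toReal_nonneg
  have hF : firstOrder M ℓ u A α β = ENNReal.ofReal F :=
    (ENNReal.ofReal_toReal (firstOrder_ne_top hKL ℓ u A α β)).symm
  have hlogc : Real.log (((K : ℝ) - ℓ) * K) ≤ Real.log K + Real.log K := by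
    have h1 : (0 : ℝ) < (K : ℝ) - ℓ := sub_pos.2 (by exact_mod_cast hℓu.trans_le huK)
    rw [Real.log_mul h1.ne' hKpos.ne']
    gcongr
    linarith [ℓ.cast_nonneg (α := ℝ)]
  have hlogd : Real.log ((u : ℝ) * K) ≤ Real.log K + Real.log K := by
    have h1 : (0 : ℝ) < u := by exact_mod_cast (by omega : 0 < u)
    rw [Real.log_mul h1.ne' hKpos.ne']
    gcongr
  have hle := hC (T_GI M ℓ u α β) (⌈(F + C₀) / r⌉₊ + 1) fun n hn ω hω => by
    rw [T_GI, gapIntersectionTime_eq]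
    refine firstTime_le_iff.2 ⟨n, le_rfl, by omega, ?_⟩
    have hn' : F + C₀ ≤ r * n := by
      rw [← div_le_iff₀' hr]
      refine (Nat.le_ceil _).trans ?_
      exact_mod_cast (by omega : ⌈(F + C₀) / r⌉₊ ≤ n)
    have hscale : ∀ D : ℝ, 0 < D → (F + C₀) * D ≤ r * n * D := fun D hD =>
      mul_le_mul_of_nonneg_right hn' hD.le
    refine mem_stopRegion_of_driftsFast hℓu huK hA (threshold_pos hK1 hβ) (threshold_pos hK1 hα)
      hKL hr hω ?_ ?_ ?_ ?_
    · intro hu k hk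
      have h1 : absLog β / η₀ M A ≤ ENNReal.ofReal F := by
        rw [← hF, firstOrder]
        split_ifs
        exacts [le_max_left _ _, le_max_left _ _]
      have h2 := abs_log_le_mul_of_div_le (η₀_le M hk) (hKL k).2.2.1 hF0 h1
      linarith [hscale _ (hKL k).2.2.1, hC₀0 k]
    · intro hl k hk
      have h1 : absLog α / η₁ M A ≤ ENNReal.ofReal F := by
        rw [← hF, firstOrder, if_neg hl.ne']
        split_ifs
        exacts [le_max_right _ _, le_max_left _ _]
      have h2 := abs_log_le_mul_of_div_le (η₁_le M hk) (hKL k).2.2.2 hF0 h1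
      linarith [hscale _ (hKL k).2.2.2, hC₀1 k]
    · intro hl i hi j hj
      have hD := add_pos (hKL j).2.2.1 (hKL i).2.2.2
      have h1 : absLog α / (η₀ M A + η₁ M A) ≤ ENNReal.ofReal F := by
        rw [← hF, firstOrder, if_pos hl]
        exact le_max_right _ _
      have h2 := abs_log_le_mul_of_div_le (by
        rw [ENNReal.ofReal_add (hKL j).2.2.1.le (hKL i).2.2.2.le]
        exact add_le_add (η₀_le M hj) (η₁_le M hi)) hD hF0 h1
      linarith [hscale _ hD, hC₀1 i, hC₀0 j]
    · intro hu i hi j hj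
      have hD := add_pos (hKL j).2.2.1 (hKL i).2.2.2
      have h1 : absLog β / (η₀ M A + η₁ M A) ≤ ENNReal.ofReal F := by
        rw [← hF, firstOrder, if_neg (by omega), if_neg (by omega)]
        exact le_max_right _ _
      have h2 := abs_log_le_mul_of_div_le (by
        rw [ENNReal.ofReal_add (hKL j).2.2.1.le (hKL i).2.2.2.le]
        exact add_le_add (η₀_le M hj) (η₁_le M hi)) hD hF0 h1
      linarith [hscale _ hD, hC₀1 i, hC₀0 j]
  refine hle.trans (ENNReal.ofReal_le_ofReal ?_)
  have h1 := Nat.ceil_lt_add_one (div_nonneg (add_nonneg hF0 hC₀) hr.le)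
  have h2 := add_div F C₀ r
  push_cast
  linarith

/-! ### Error control -/

lemma measurableSet_eq_top {T : Path S → ℕ∞} (hT : IsStoppingTime (ℱ S) T) :
    MeasurableSet {ω | T ω = ⊤} := by
  have : {ω | T ω = ⊤} = (⋃ n : ℕ, {ω | T ω = n})ᶜ := by
    ext ω
    simp only [Set.mem_ofPred_eq, Set.mem_compl_iff, Set.mem_iUnion, not_exists]
    exact ⟨fun h n => by simp [h], fun h => by
      by_contra hne; exact h (T ω).toNat (ENat.natCast_toNat hne).symm⟩
  rw [this]
  exact (MeasurableSet.iUnion fun n => (ℱ S).le n _ (hT.measurableSet_eq n)).compl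

lemma P_eq_top_of_expectedTime_ne_top {A : Finset (Fin K)} {T : Path S → ℕ∞}
    (hT : IsStoppingTime (ℱ S) T) (h : expectedTime M A T ≠ ∞) : P M A {ω | T ω = ⊤} = 0 := by
  by_contra hne
  refine h (top_le_iff.1 ?_)
  calc (∞ : ℝ≥0∞) = ∞ * P M A {ω | T ω = ⊤} := (ENNReal.top_mul hne).symm
    _ = ∫⁻ _ in {ω | T ω = ⊤}, ∞ ∂(P M A) := (setLIntegral_const _ _).symm
    _ = ∫⁻ ω in {ω | T ω = ⊤}, (T ω : ℝ≥0∞) ∂(P M A) :=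
        setLIntegral_congr_fun (measurableSet_eq_top hT) fun ω hω => by
          have : T ω = ⊤ := hω
          simp [this]
    _ ≤ expectedTime M A T := setLIntegral_le_lintegral _ _

/-- The union bound over a finite family of alternatives `C p` to `A`, for the events controlled
by `P_stop_mem_le`. -/
lemma P_stop_exists_le {A : Finset (Fin K)} {T : Path S → ℕ∞} (hT : IsStoppingTime (ℱ S) T)
    {ι : Type*} (I : Finset ι) {G : ι → Set (Fin K → ℝ)} (hG : ∀ p ∈ I, MeasurableSet (G p))
    (C : ι → Finset (Fin K)) {b : ℝ} (hb : ∀ p ∈ I, ∀ x ∈ G p, lrSum A (C p) x ≤ -b) :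
    P M A {ω | ∃ n : ℕ, T ω = n ∧ ∃ p ∈ I, llr M ω n ∈ G p} ≤
      ENNReal.ofReal (I.card * Real.exp (-b)) := by
  have : {ω | ∃ n : ℕ, T ω = n ∧ ∃ p ∈ I, llr M ω n ∈ G p} =
      ⋃ p ∈ I, {ω | ∃ n : ℕ, T ω = n ∧ llr M ω n ∈ G p} := by
    ext ω
    simp only [Set.mem_ofPred_eq, Set.mem_iUnion, exists_prop]
    exact ⟨fun ⟨n, h, p, hp, hx⟩ => ⟨p, hp, n, h, hx⟩, fun ⟨p, hp, n, h, hx⟩ => ⟨n, h, p, hp, hx⟩⟩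
  rw [this]
  refine (measure_biUnion_finset_le _ _).trans ?_
  refine (Finset.sum_le_sum fun p hp => P_stop_mem_le M A (C p) hT (hG p hp) (hb p hp)).trans ?_
  rw [Finset.sum_const, nsmul_eq_mul, ENNReal.ofReal_mul (by positivity), ENNReal.ofReal_natCast]

lemma exp_neg_abs_log_add_log {x m : ℝ} (hx : x ∈ Set.Ioo (0 : ℝ) 1) (hm : 0 < m) :
    Real.exp (-(|Real.log x| + Real.log m)) = x / m := by
  rw [abs_of_neg (Real.log_neg hx.1 hx.2), neg_add, neg_neg, Real.exp_add, Real.exp_neg,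
    Real.exp_log hx.1, Real.exp_log hm, div_eq_mul_inv]

/-- The gap-intersection rule controls both familywise error probabilities. A false positive
requires that `λ^j ≥ b` for some `j ∉ A`, or that `λ^j - λ^i ≥ c` for some `j ∉ A`, `i ∈ A`;
such events have probabilities at most `exp (-b)` and `exp (-c)`. -/
theorem gapIntersection_mem_Δ (hKL : ∀ k, (M k).KLPosFinite) {ℓ u : ℕ} (hℓu : ℓ < u)
    (huK : u ≤ K) {α β : ℝ} (hα : α ∈ Set.Ioo (0 : ℝ) 1) (hβ : β ∈ Set.Ioo (0 : ℝ) 1) :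
    (T_GI M ℓ u α β, d_GI M ℓ u α β) ∈ Δ M (sizeClass K ℓ u) α β := by
  have hK1 : 1 ≤ K := by omega
  have hKpos : (0 : ℝ) < K := by exact_mod_cast hK1
  have hupos : (0 : ℝ) < u := by exact_mod_cast (by omega : 0 < u)
  have hKℓ : (0 : ℝ) < (K : ℝ) - ℓ := sub_pos.2 (by exact_mod_cast hℓu.trans_le huK)
  have htest : IsSequentialTest (T_GI M ℓ u α β) (d_GI M ℓ u α β) :=
    isSequentialTest_gapIntersection M hℓu huK _ _ _ _
  refine ⟨htest, fun A hA => ?_⟩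
  obtain ⟨hT, -⟩ := htest.2
  have htop : P M A {ω | T_GI M ℓ u α β ω = ⊤} = 0 := by
    obtain ⟨C, hC⟩ := exists_expectedTime_T_GI_le hKL hℓu huK hA (r := 1 / 2) (by norm_num)
      (by norm_num)
    exact P_eq_top_of_expectedTime_ne_top hT
      (ne_top_of_le_ne_top ENNReal.ofReal_ne_top (hC α hα β hβ))
  have hregion : ∀ (ω : Path S) (n : ℕ), T_GI M ℓ u α β ω = n →
      llr M ω n ∈ stopRegion K ℓ u (|Real.log β| + Real.log K) (|Real.log α| + Real.log K)
        (|Real.log α| + Real.log (((K : ℝ) - ℓ) * K)) (|Real.log β| + Real.log ((u : ℝ) * K)) ∧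
      d_GI M ℓ u α β ω = decision ℓ u (llr M ω n) := by
    intro ω n h
    constructor
    · rw [T_GI, gapIntersectionTime_eq] at h
      exact of_firstTime_eq h
    · change decision ℓ u (llr M ω (T_GI M ℓ u α β ω).toNat) = _
      rw [h]; simp
  have hcardA : (A.card : ℝ) ≤ K := by
    exact_mod_cast A.card_le_univ.trans_eq (Fintype.card_fin K)
  have hcardc : ((Aᶜ.card : ℕ) : ℝ) = K - A.card := by
    rw [Finset.card_compl, Fintype.card_fin, Nat.cast_sub (by exact_mod_cast hcardA)]
  have hA1 : (ℓ : ℝ) ≤ A.card := by exact_mod_cast hA.1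
  have hA2 : (A.card : ℝ) ≤ u := by exact_mod_cast hA.2
  have ha := threshold_pos hK1 hβ
  have hb := threshold_pos hK1 hα
  constructor
  · refine (measure_mono (t := {ω | T_GI M ℓ u α β ω = ⊤} ∪
      ({ω | ∃ n : ℕ, T_GI M ℓ u α β ω = n ∧ ∃ j ∈ Aᶜ,
          llr M ω n ∈ {x : Fin K → ℝ | |Real.log α| + Real.log K ≤ x j}} ∪
        {ω | ∃ n : ℕ, T_GI M ℓ u α β ω = n ∧ ∃ p ∈ Aᶜ ×ˢ A, llr M ω n ∈
          {x : Fin K → ℝ | |Real.log α| + Real.log (((K : ℝ) - ℓ) * K) ≤ x p.1 - x p.2}})) ?_).trans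
      ((measure_union_le _ _).trans ?_)
    · intro ω hω
      rcases eq_or_ne (T_GI M ℓ u α β ω) ⊤ with h | h
      · exact Or.inl h
      · right
        have hn := (ENat.natCast_toNat h).symm
        obtain ⟨hx, hd⟩ := hregion ω _ hn
        have hω' : (d_GI M ℓ u α β ω \ A).Nonempty := hω
        rw [hd] at hω'
        rcases exists_of_false_positive hℓu huK ha hb hx hA.1 hω' with
          ⟨j, hj, hj'⟩ | ⟨j, hj, i, hi, hij⟩
        · exact Or.inl ⟨_, hn, j, Finset.mem_compl.2 hj, hj'⟩
        · exact Or.inr ⟨_, hn, (j, i), Finset.mem_product.2 ⟨Finset.mem_compl.2 hj, hi⟩, hij⟩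
    · rw [htop, zero_add]
      refine (measure_union_le _ _).trans ((add_le_add
        (P_stop_exists_le hT Aᶜ (fun j _ => measurableSet_le measurable_const
          (measurable_pi_apply j)) (fun j => insert j A) (b := |Real.log α| + Real.log K) ?_)
        (P_stop_exists_le hT (Aᶜ ×ˢ A) (fun p _ => measurableSet_le_sub _ p.1 p.2)
          (fun p => insert p.1 (A.erase p.2))
          (b := |Real.log α| + Real.log (((K : ℝ) - ℓ) * K)) ?_)).trans ?_)
      · intro j hj x hx
        rw [lrSum_insert (Finset.mem_compl.1 hj), lrSum_self, zero_sub]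
        exact neg_le_neg hx
      · intro p hp x hx
        obtain ⟨h1, h2⟩ := Finset.mem_product.1 hp
        rw [lrSum_swap h2 (Finset.mem_compl.1 h1)]
        have : |Real.log α| + Real.log (((K : ℝ) - ℓ) * K) ≤ x p.1 - x p.2 := hx
        linarith
      · rw [exp_neg_abs_log_add_log hα hKpos, exp_neg_abs_log_add_log hα (by positivity),
          ← ENNReal.ofReal_add (by have := hα.1; positivity) (by have := hα.1; positivity),
          Finset.card_product, Nat.cast_mul, hcardc]
        refine ENNReal.ofReal_le_ofReal ?_
        have h1 : ((K : ℝ) - A.card) / (K - ℓ) ≤ 1 := (div_le_one hKℓ).2 (by linarith)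
        have h2 : 0 ≤ α * A.card / K := by have := hα.1; positivity
        calc ((K : ℝ) - A.card) * (α / K) + ((K : ℝ) - A.card) * A.card * (α / ((K - ℓ) * K))
            = α * (K - A.card) / K + α * A.card / K * (((K : ℝ) - A.card) / (K - ℓ)) := by
              field_simp
          _ ≤ α * (K - A.card) / K + α * A.card / K * 1 := by gcongr
          _ = α := by field_simp; ring
  · refine (measure_mono (t := {ω | T_GI M ℓ u α β ω = ⊤} ∪
      ({ω | ∃ n : ℕ, T_GI M ℓ u α β ω = n ∧ ∃ i ∈ A,
          llr M ω n ∈ {x : Fin K → ℝ | x i ≤ -(|Real.log β| + Real.log K)}} ∪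
        {ω | ∃ n : ℕ, T_GI M ℓ u α β ω = n ∧ ∃ p ∈ Aᶜ ×ˢ A, llr M ω n ∈
          {x : Fin K → ℝ | |Real.log β| + Real.log ((u : ℝ) * K) ≤ x p.1 - x p.2}})) ?_).trans
      ((measure_union_le _ _).trans ?_)
    · intro ω hω
      rcases eq_or_ne (T_GI M ℓ u α β ω) ⊤ with h | h
      · exact Or.inl h
      · right
        have hn := (ENat.natCast_toNat h).symm
        obtain ⟨hx, hd⟩ := hregion ω _ hn
        have hω' : (A \ d_GI M ℓ u α β ω).Nonempty := hω
        rw [hd] at hω'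
        rcases exists_of_false_negative hℓu huK ha hb hx hA.2 hω' with
          ⟨i, hi, hi'⟩ | ⟨j, hj, i, hi, hij⟩
        · exact Or.inl ⟨_, hn, i, hi, hi'⟩
        · exact Or.inr ⟨_, hn, (j, i), Finset.mem_product.2 ⟨Finset.mem_compl.2 hj, hi⟩, hij⟩
    · rw [htop, zero_add]
      refine (measure_union_le _ _).trans ((add_le_add
        (P_stop_exists_le hT A (fun i _ => measurableSet_le
          (measurable_pi_apply i) measurable_const) (fun i => A.erase i)
          (b := |Real.log β| + Real.log K) ?_)
        (P_stop_exists_le hT (Aᶜ ×ˢ A) (fun p _ => measurableSet_le_sub _ p.1 p.2)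
          (fun p => insert p.1 (A.erase p.2))
          (b := |Real.log β| + Real.log ((u : ℝ) * K)) ?_)).trans ?_)
      · intro i hi x hx
        rw [lrSum_erase hi, lrSum_self, zero_add]
        exact hx
      · intro p hp x hx
        obtain ⟨h1, h2⟩ := Finset.mem_product.1 hp
        rw [lrSum_swap h2 (Finset.mem_compl.1 h1)]
        have : |Real.log β| + Real.log ((u : ℝ) * K) ≤ x p.1 - x p.2 := hx
        linarith
      · rw [exp_neg_abs_log_add_log hβ hKpos, exp_neg_abs_log_add_log hβ (by positivity),
          ← ENNReal.ofReal_add (by have := hβ.1; positivity) (by have := hβ.1; positivity),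
          Finset.card_product, Nat.cast_mul, hcardc]
        refine ENNReal.ofReal_le_ofReal ?_
        have h1 : (A.card : ℝ) / u ≤ 1 := (div_le_one hupos).2 hA2
        have h2 : 0 ≤ β * (K - A.card) / K :=
          div_nonneg (mul_nonneg hβ.1.le (by linarith)) hKpos.le
        calc (A.card : ℝ) * (β / K) + ((K : ℝ) - A.card) * A.card * (β / (u * K))
            = β * A.card / K + β * (K - A.card) / K * ((A.card : ℝ) / u) := by
              field_simp
          _ ≤ β * A.card / K + β * (K - A.card) / K * 1 := by gcongr
          _ = β := by field_simp; ring

/-! ### Lower bound for the optimal expected sample size -/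

/-- A test that decides for `A` with high probability under `P_A`, but only with probability `γ`
under `P_C`, needs about `|log γ| / infoSum M A C` observations under `P_A`. With `n` slightly
smaller than this number, `{d = A, T ≤ n}` belongs to `ℱ n`. By a change of measure at time `n`
its `P_A`-probability is at most `exp c * γ` plus the probability that the log-likelihood ratio of
`P_A` to `P_C` at time `n` exceeds `c`; for `c` slightly smaller than `|log γ|` both are small. -/
theorem exists_le_expectedTime (hKL : ∀ k, (M k).KLPosFinite) {A C : Finset (Fin K)}
    (hI : 0 < infoSum M A C) {δ : ℝ} (hδ : 0 < δ) (hδ1 : 3 * δ < 1) :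
    ∃ L₀ : ℝ, ∀ γ ∈ Set.Ioo (0 : ℝ) 1, L₀ ≤ |Real.log γ| →
      ∀ (T : Path S → ℕ∞) (d : Path S → Finset (Fin K)), IsSequentialTest T d →
      P M A {ω | d ω ≠ A} ≤ ENNReal.ofReal δ → P M C {ω | d ω = A} ≤ ENNReal.ofReal γ →
      ENNReal.ofReal ((1 - 4 * δ) * (|Real.log γ| / infoSum M A C)) ≤ expectedTime M A T := by
  set I := infoSum M A C with hIdef
  have h1δ : 0 < 1 - δ := by linarith
  set c' : ℝ := I * (1 - δ / 2) / (1 - δ) with hc'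
  have hIc : I < c' := by
    rw [hc', lt_div_iff₀ h1δ]
    nlinarith
  have hev := (tendsto_P_lt_lrSum hKL A C hIc).eventually_le_const
    (ENNReal.ofReal_pos.2 hδ)
  obtain ⟨n₁, hn₁⟩ := eventually_atTop.1 hev
  refine ⟨max ((n₁ + 1) * I / (1 - δ)) (2 / δ * |Real.log δ|),
    fun γ hγ hL T d htest hdA hdC => ?_⟩
  obtain ⟨hT, hd⟩ := htest.2
  have hL1 := (le_max_left _ _).trans hL
  have hL2 := (le_max_right _ _).trans hL
  set L := |Real.log γ| with hLdef
  have hL0 : 0 < L := abs_log_pos hγ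
  set n : ℕ := ⌊(1 - δ) * (L / I)⌋₊ with hn
  have hx0 : 0 ≤ (1 - δ) * (L / I) := by positivity
  have hnle : (n : ℝ) ≤ (1 - δ) * (L / I) := Nat.floor_le hx0
  have hnlt : (1 - δ) * (L / I) < n + 1 := Nat.lt_floor_add_one _
  have hn1 : n₁ ≤ n := by
    rw [div_le_iff₀ h1δ] at hL1
    have : (n₁ : ℝ) + 1 ≤ (1 - δ) * (L / I) := by
      rw [mul_div_assoc', le_div_iff₀ hI]; linarith
    exact Nat.le_floor (by linarith)
  set c : ℝ := (1 - δ / 2) * L with hc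
  have hcn : c' * n ≤ c := by
    calc c' * n ≤ c' * ((1 - δ) * (L / I)) := by
          have : 0 ≤ c' := (hI.trans hIc).le
          gcongr
      _ = c := by rw [hc', hc]; field_simp
  have hexp : Real.exp c * γ ≤ δ := by
    have hγe : γ = Real.exp (-L) := by
      rw [hLdef, abs_of_neg (Real.log_neg hγ.1 hγ.2), neg_neg, Real.exp_log hγ.1]
    have h2 : |Real.log δ| ≤ δ / 2 * L := by
      have := mul_le_mul_of_nonneg_left hL2 (by positivity : 0 ≤ δ / 2)
      rwa [← mul_assoc, show δ / 2 * (2 / δ) = 1 by field_simp, one_mul] at this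
    rw [hγe, ← Real.exp_add]
    calc Real.exp (c + -L) ≤ Real.exp (Real.log δ) := by
          apply Real.exp_le_exp.2
          have := neg_abs_le (Real.log δ)
          rw [hc]; linarith
      _ = δ := Real.exp_log hδ
  -- the event `{d = A, T ≤ n}` is known at time `n`
  have hEm : MeasurableSet[ℱ S n] ({ω | d ω = A} ∩ {ω | T ω ≤ n}) := by
    have hdm : MeasurableSet[hT.measurableSpace] {ω | d ω = A} := by
      have : {ω | d ω = A} = ⋂ k, {ω | k ∈ d ω ↔ k ∈ A} := by
        ext ω; simp [Finset.ext_iff]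
      rw [this]
      refine @MeasurableSet.iInter _ _ hT.measurableSpace _ _ fun k => ?_
      by_cases hk : k ∈ A
      · simpa [hk] using hd k
      · have : {ω | k ∈ d ω ↔ k ∈ A} = {ω | k ∈ d ω}ᶜ := by ext ω; simp [hk]
        rw [this]
        exact (hd k).compl
    exact hdm.2 n
  have hlrm : MeasurableSet[ℱ S n] {ω | lrSum A C (llr M ω n) ≤ c} :=
    measurable_llr_ℱ M n (measurableSet_le (measurable_lrSum A C) measurable_const)
  have hTn : P M A {ω | T ω ≤ n} ≤ ENNReal.ofReal (3 * δ) := by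
    have hsub : {ω | T ω ≤ n} ⊆ {ω | d ω ≠ A} ∪
        ((({ω | d ω = A} ∩ {ω | T ω ≤ n}) ∩ {ω | lrSum A C (llr M ω n) ≤ c}) ∪
          {ω | c' * n < lrSum A C (llr M ω n)}) := by
      intro ω hω
      by_cases h1 : d ω = A
      · right
        rcases le_or_gt (lrSum A C (llr M ω n)) c with h2 | h2
        · exact Or.inl ⟨⟨h1, hω⟩, h2⟩
        · exact Or.inr (hcn.trans_lt h2)
      · exact Or.inl h1
    have h2 : P M A (({ω | d ω = A} ∩ {ω | T ω ≤ n}) ∩ {ω | lrSum A C (llr M ω n) ≤ c}) ≤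
        ENNReal.ofReal δ := by
      refine (P_le_exp_mul M A C n (@MeasurableSet.inter _ (ℱ S n) _ _ hEm hlrm)
        fun ω hω => hω.2).trans ?_
      refine (mul_le_mul_right ((measure_mono fun ω hω => hω.1.1).trans hdC) _).trans ?_
      rw [← ENNReal.ofReal_mul (Real.exp_pos _).le]
      exact ENNReal.ofReal_le_ofReal hexp
    calc P M A {ω | T ω ≤ n} ≤ ENNReal.ofReal δ + (ENNReal.ofReal δ + ENNReal.ofReal δ) :=
          (measure_mono hsub).trans ((measure_union_le _ _).trans (add_le_add hdA
            ((measure_union_le _ _).trans (add_le_add h2 (hn₁ n hn1)))))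
      _ = ENNReal.ofReal (3 * δ) := by
          rw [← ENNReal.ofReal_add hδ.le hδ.le, ← ENNReal.ofReal_add hδ.le (by positivity)]
          congr 1; ring
  have hTm : MeasurableSet {ω | T ω ≤ n} := (ℱ S).le n _ (hT n)
  have hTc : ENNReal.ofReal (1 - 3 * δ) ≤ P M A {ω | T ω ≤ n}ᶜ := by
    rw [prob_compl_eq_one_sub hTm, ENNReal.ofReal_sub _ (by positivity), ENNReal.ofReal_one]
    exact tsub_le_tsub_left hTn 1
  calc ENNReal.ofReal ((1 - 4 * δ) * (L / I))
      ≤ ENNReal.ofReal ((n + 1 : ℕ) * (1 - 3 * δ)) := by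
        refine ENNReal.ofReal_le_ofReal ?_
        have h3 : 0 ≤ L / I := by positivity
        have h4 : 0 ≤ δ ^ 2 * (L / I) := by positivity
        have h5 := mul_le_mul_of_nonneg_right hnlt.le (by linarith : 0 ≤ 1 - 3 * δ)
        push_cast
        nlinarith
    _ = ((n + 1 : ℕ) : ℝ≥0∞) * ENNReal.ofReal (1 - 3 * δ) := by
        rw [ENNReal.ofReal_mul (by positivity), ENNReal.ofReal_natCast]
    _ ≤ ((n + 1 : ℕ) : ℝ≥0∞) * P M A {ω | T ω ≤ n}ᶜ := by gcongr
    _ = ∫⁻ _ in {ω | T ω ≤ n}ᶜ, ((n + 1 : ℕ) : ℝ≥0∞) ∂(P M A) := (setLIntegral_const _ _).symm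
    _ ≤ ∫⁻ ω in {ω | T ω ≤ n}ᶜ, (T ω : ℝ≥0∞) ∂(P M A) := by
        refine setLIntegral_mono' hTm.compl fun ω hω => ?_
        have h6 : (n : ℕ∞) < T ω := not_le.1 hω
        have h7 : ((n + 1 : ℕ) : ℕ∞) ≤ T ω := by
          push_cast
          exact Order.add_one_le_of_lt h6
        exact_mod_cast ENat.toENNReal_le.2 h7
    _ ≤ expectedTime M A T := setLIntegral_le_lintegral _ _

lemma P_decision_ne_le {𝒞 : Set (Finset (Fin K))} {A : Finset (Fin K)} (hA : A ∈ 𝒞) {α β : ℝ}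
    (hα : 0 ≤ α) (hβ : 0 ≤ β) {t : (Path S → ℕ∞) × (Path S → Finset (Fin K))}
    (ht : t ∈ Δ M 𝒞 α β) : P M A {ω | t.2 ω ≠ A} ≤ ENNReal.ofReal (α + β) := by
  rw [ENNReal.ofReal_add hα hβ]
  refine (measure_mono ?_).trans ((measure_union_le _ _).trans
    (add_le_add (ht.2 A hA).1 (ht.2 A hA).2))
  intro ω hω
  by_contra hc
  simp only [Set.mem_union, Set.mem_ofPred_eq, not_or, Finset.not_nonempty_iff_eq_empty,
    Finset.sdiff_eq_empty_iff_subset] at hc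
  exact hω (hc.1.antisymm hc.2)

lemma tendsto_abs_log_zero : Tendsto (fun x : ℝ => |Real.log x|) (𝓝[>] 0) atTop :=
  tendsto_abs_atBot_atTop.comp Real.tendsto_log_nhdsGT_zero

lemma eventually_mem_Ioo {δ : ℝ} (hδ : 0 < δ) : ∀ᶠ q : ℝ × ℝ in 𝓝[>] (0 : ℝ) ×ˢ 𝓝[>] (0 : ℝ),
    q.1 ∈ Set.Ioo 0 δ ∧ q.2 ∈ Set.Ioo 0 δ :=
  prod_mem_prod (Ioo_mem_nhdsGT hδ) (Ioo_mem_nhdsGT hδ)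

/-- The lower bound on the optimal expected sample size under `P_A` that comes from an alternative
`C`. Here `γ (α, β)` is whichever of `α`, `β` bounds the probability, under `P_C`, of deciding
for `A`. -/
lemma eventually_le_optimalTime (hKL : ∀ k, (M k).KLPosFinite) {𝒞 : Set (Finset (Fin K))}
    {A C : Finset (Fin K)} (hA : A ∈ 𝒞) (hI : 0 < infoSum M A C) {γ : ℝ × ℝ → ℝ}
    (hγ : Tendsto γ (𝓝[>] (0 : ℝ) ×ˢ 𝓝[>] (0 : ℝ)) (𝓝[>] 0))
    (hC : ∀ q : ℝ × ℝ, ∀ t ∈ Δ M 𝒞 q.1 q.2, P M C {ω | t.2 ω = A} ≤ ENNReal.ofReal (γ q))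
    {δ : ℝ} (hδ : 0 < δ) (hδ1 : 3 * δ < 1) :
    ∀ᶠ q : ℝ × ℝ in 𝓝[>] (0 : ℝ) ×ˢ 𝓝[>] (0 : ℝ),
      ENNReal.ofReal (1 - 4 * δ) * (absLog (γ q) / ENNReal.ofReal (infoSum M A C)) ≤
        optimalTime M 𝒞 A q.1 q.2 := by
  obtain ⟨L₀, hL₀⟩ := exists_le_expectedTime hKL hI hδ hδ1
  filter_upwards [eventually_mem_Ioo (half_pos hδ),
    (tendsto_abs_log_zero.comp hγ).eventually_ge_atTop L₀,
    hγ (Ioo_mem_nhdsGT one_pos)] with q hq hqL hq1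
  refine le_iInf₂ fun t ht => ?_
  have := hL₀ (γ q) hq1 hqL t.1 t.2 ht.1
    ((P_decision_ne_le hA hq.1.1.le hq.2.1.le ht).trans
      (ENNReal.ofReal_le_ofReal (by linarith [hq.1.2, hq.2.2]))) (hC q t ht)
  rw [absLog, ← ENNReal.ofReal_div_of_pos hI]
  rwa [ENNReal.ofReal_mul' (by positivity)] at this

section Alternatives

variable {A : Finset (Fin K)} {i j : Fin K}

lemma infoSum_insert (hj : j ∉ A) : infoSum M A (insert j A) = (M j).D₀ := by
  rw [infoSum, lrSum_insert hj, lrSum_self]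
  simp [driftSign, drift, hj]

lemma infoSum_erase (hi : i ∈ A) : infoSum M A (A.erase i) = (M i).D₁ := by
  rw [infoSum, lrSum_erase hi, lrSum_self]
  simp [driftSign, drift, hi]

lemma infoSum_swap (hi : i ∈ A) (hj : j ∉ A) :
    infoSum M A (insert j (A.erase i)) = (M j).D₀ + (M i).D₁ := by
  rw [infoSum, lrSum_swap hi hj]
  simp [driftSign, drift, hi, hj, add_comm]

lemma P_decision_eq_le_left {𝒞 : Set (Finset (Fin K))} {C : Finset (Fin K)} (hC : C ∈ 𝒞)
    (hi : i ∈ A) (hiC : i ∉ C) {α β : ℝ} {t : (Path S → ℕ∞) × (Path S → Finset (Fin K))}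
    (ht : t ∈ Δ M 𝒞 α β) : P M C {ω | t.2 ω = A} ≤ ENNReal.ofReal α := by
  refine (measure_mono fun ω hω => ?_).trans (ht.2 C hC).1
  have hω' : t.2 ω = A := hω
  exact ⟨i, Finset.mem_sdiff.2 ⟨hω' ▸ hi, hiC⟩⟩

lemma P_decision_eq_le_right {𝒞 : Set (Finset (Fin K))} {C : Finset (Fin K)} (hC : C ∈ 𝒞)
    (hj : j ∉ A) (hjC : j ∈ C) {α β : ℝ} {t : (Path S → ℕ∞) × (Path S → Finset (Fin K))}
    (ht : t ∈ Δ M 𝒞 α β) : P M C {ω | t.2 ω = A} ≤ ENNReal.ofReal β := by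
  refine (measure_mono fun ω hω => ?_).trans (ht.2 C hC).2
  have hω' : t.2 ω = A := hω
  exact ⟨j, Finset.mem_sdiff.2 ⟨hjC, hω' ▸ hj⟩⟩

lemma card_swap (hi : i ∈ A) (hj : j ∉ A) : (insert j (A.erase i)).card = A.card := by
  rw [Finset.card_insert_of_notMem fun h => hj (Finset.mem_of_mem_erase h),
    Finset.card_erase_of_mem hi]
  have := Finset.card_pos.2 ⟨i, hi⟩
  omega

end Alternatives

/-- Up to a factor arbitrarily close to one, no test beats the explicit first-order value. The
alternatives to `A` that matter are `A` with a stream added (if `|A| < u`), with a stream removed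
(if `ℓ < |A|`), and with a stream exchanged (if `|A| = ℓ` or `|A| = u`). -/
theorem eventually_firstOrder_le_optimalTime (hKL : ∀ k, (M k).KLPosFinite) {ℓ u : ℕ}
    (hℓu : ℓ < u) (huK : u ≤ K) {A : Finset (Fin K)} (hA : A ∈ sizeClass K ℓ u) {δ : ℝ}
    (hδ : 0 < δ) (hδ1 : 3 * δ < 1) :
    ∀ᶠ q : ℝ × ℝ in 𝓝[>] (0 : ℝ) ×ˢ 𝓝[>] (0 : ℝ),
      ENNReal.ofReal (1 - 4 * δ) * firstOrder M ℓ u A q.1 q.2 ≤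
        optimalTime M (sizeClass K ℓ u) A q.1 q.2 := by
  have hadd : A.card < u → ∀ᶠ q : ℝ × ℝ in 𝓝[>] (0 : ℝ) ×ˢ 𝓝[>] (0 : ℝ),
      ENNReal.ofReal (1 - 4 * δ) * (absLog q.2 / η₀ M A) ≤
        optimalTime M (sizeClass K ℓ u) A q.1 q.2 := by
    intro hu
    obtain ⟨j, hj, hη⟩ := exists_η₀_eq M (hu.trans_le huK)
    have hC : insert j A ∈ sizeClass K ℓ u := by
      have := Finset.card_insert_of_notMem hj
      exact ⟨by have := hA.1; omega, by omega⟩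
    have h := eventually_le_optimalTime hKL hA (C := insert j A)
      (by rw [infoSum_insert hj]; exact (hKL j).2.2.1) (γ := Prod.snd) tendsto_snd
      (fun q t ht => P_decision_eq_le_right hC hj (Finset.mem_insert_self j A) ht) hδ hδ1
    rwa [infoSum_insert hj, ← hη] at h
  have hrem : ℓ < A.card → ∀ᶠ q : ℝ × ℝ in 𝓝[>] (0 : ℝ) ×ˢ 𝓝[>] (0 : ℝ),
      ENNReal.ofReal (1 - 4 * δ) * (absLog q.1 / η₁ M A) ≤
        optimalTime M (sizeClass K ℓ u) A q.1 q.2 := by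
    intro hl
    obtain ⟨i, hi, hη⟩ := exists_η₁_eq M (Finset.card_pos.1 (by omega : 0 < A.card))
    have hC : A.erase i ∈ sizeClass K ℓ u := by
      have := Finset.card_erase_of_mem hi
      exact ⟨by omega, by have := hA.2; omega⟩
    have h := eventually_le_optimalTime hKL hA (C := A.erase i)
      (by rw [infoSum_erase hi]; exact (hKL i).2.2.2) (γ := Prod.fst) tendsto_fst
      (fun q t ht => P_decision_eq_le_left hC hi (Finset.notMem_erase i A) ht) hδ hδ1
    rwa [infoSum_erase hi, ← hη] at h
  -- without a stream to exchange the denominator `η₀ + η₁` is infinite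
  have hswap : ∀ᶠ q : ℝ × ℝ in 𝓝[>] (0 : ℝ) ×ˢ 𝓝[>] (0 : ℝ),
      ENNReal.ofReal (1 - 4 * δ) * (absLog q.1 / (η₀ M A + η₁ M A)) ≤
        optimalTime M (sizeClass K ℓ u) A q.1 q.2 ∧
      ENNReal.ofReal (1 - 4 * δ) * (absLog q.2 / (η₀ M A + η₁ M A)) ≤
        optimalTime M (sizeClass K ℓ u) A q.1 q.2 := by
    rcases A.eq_empty_or_nonempty with hAe | hAne
    · simp [η₁, hAe]
    rcases (A.card_le_univ.trans_eq (Fintype.card_fin K)).eq_or_lt with hAK | hAK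
    · have hAu : A = Finset.univ := Finset.eq_univ_of_card A (by simpa using hAK)
      simp [η₀, hAu]
    obtain ⟨i, hi, hη₁⟩ := exists_η₁_eq M hAne
    obtain ⟨j, hj, hη₀⟩ := exists_η₀_eq M hAK
    have hC : insert j (A.erase i) ∈ sizeClass K ℓ u := by
      have := card_swap hi hj
      exact ⟨by have := hA.1; omega, by have := hA.2; omega⟩
    have hI : 0 < infoSum M A (insert j (A.erase i)) := by
      rw [infoSum_swap hi hj]; exact add_pos (hKL j).2.2.1 (hKL i).2.2.2
    have hiC : i ∉ insert j (A.erase i) := by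
      have : i ≠ j := fun h => hj (h ▸ hi)
      simp [this]
    have h1 := eventually_le_optimalTime hKL hA hI (γ := Prod.fst) tendsto_fst
      (fun q t ht => P_decision_eq_le_left hC hi hiC ht) hδ hδ1
    have h2 := eventually_le_optimalTime hKL hA hI (γ := Prod.snd) tendsto_snd
      (fun q t ht => P_decision_eq_le_right hC hj (Finset.mem_insert_self j _) ht) hδ hδ1
    rw [infoSum_swap hi hj, ENNReal.ofReal_add (hKL j).2.2.1.le (hKL i).2.2.2.le, ← hη₀,
      ← hη₁] at h1 h2
    exact h1.and h2
  have hmax : ∀ {x y z w : ℝ≥0∞}, w * x ≤ z → w * y ≤ z → w * max x y ≤ z := by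
    intro x y z w hx hy
    rcases max_choice x y with h | h <;> rwa [h]
  unfold firstOrder
  split_ifs with h1 h2
  · filter_upwards [hadd (by omega), hswap] with q hq1 hq2
    exact hmax hq1 hq2.1
  · filter_upwards [hadd h2, hrem (lt_of_le_of_ne hA.1 (Ne.symm h1))] with q hq1 hq2
    exact hmax hq1 hq2
  · filter_upwards [hrem (lt_of_le_of_ne hA.1 (Ne.symm h1)), hswap] with q hq1 hq2
    exact hmax hq1 hq2.2

lemma tendsto_firstOrder (hKL : ∀ k, (M k).KLPosFinite) {ℓ u : ℕ} (hℓu : ℓ < u) (huK : u ≤ K)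
    {A : Finset (Fin K)} (hA : A ∈ sizeClass K ℓ u) :
    Tendsto (fun q : ℝ × ℝ => (firstOrder M ℓ u A q.1 q.2).toReal)
      (𝓝[>] (0 : ℝ) ×ˢ 𝓝[>] (0 : ℝ)) atTop := by
  have key : ∀ (f : ℝ × ℝ → ℝ) (D : ℝ), 0 < D →
      Tendsto f (𝓝[>] (0 : ℝ) ×ˢ 𝓝[>] (0 : ℝ)) (𝓝[>] 0) →
      (∀ q : ℝ × ℝ, absLog (f q) / ENNReal.ofReal D ≤ firstOrder M ℓ u A q.1 q.2) →
      Tendsto (fun q : ℝ × ℝ => (firstOrder M ℓ u A q.1 q.2).toReal)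
        (𝓝[>] (0 : ℝ) ×ˢ 𝓝[>] (0 : ℝ)) atTop := by
    intro f D hD hf hle
    refine tendsto_atTop_mono (fun q => ?_)
      ((tendsto_abs_log_zero.comp hf).atTop_div_const hD)
    have := ENNReal.toReal_mono (firstOrder_ne_top hKL ℓ u A q.1 q.2) (hle q)
    rw [absLog, ← ENNReal.ofReal_div_of_pos hD, ENNReal.toReal_ofReal (by positivity)] at this
    exact this
  rcases hA.2.lt_or_eq with hu | hu
  · obtain ⟨j, -, hη⟩ := exists_η₀_eq M (hu.trans_le huK)
    refine key Prod.snd _ (hKL j).2.2.1 tendsto_snd fun q => ?_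
    rw [← hη, firstOrder]
    split_ifs
    exacts [le_max_left _ _, le_max_left _ _]
  · obtain ⟨i, -, hη⟩ := exists_η₁_eq M (Finset.card_pos.1 (by omega : 0 < A.card))
    refine key Prod.fst _ (hKL i).2.2.2 tendsto_fst fun q => ?_
    rw [← hη, firstOrder, if_neg (by omega), if_neg (by omega)]
    exact le_max_left _ _

/-! ### Asymptotic optimality -/

lemma tendsto_one_of_forall_bounds {ι : Type*} {l : Filter ι} {f : ι → ℝ}
    (hlow : ∀ δ : ℝ, 0 < δ → δ < 1 → ∀ᶠ i in l, 1 - δ ≤ f i)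
    (hup : ∀ δ : ℝ, 0 < δ → ∀ᶠ i in l, f i ≤ 1 + δ) : Tendsto f l (𝓝 1) := by
  refine tendsto_order.2 ⟨fun x hx => ?_, fun x hx => ?_⟩
  · have h1 : max x 0 < 1 := max_lt hx one_pos
    filter_upwards [hlow ((1 - max x 0) / 2) (by linarith) (by linarith [le_max_right x 0])]
      with i hi
    linarith [le_max_left x 0]
  · filter_upwards [hup ((x - 1) / 2) (by linarith)] with i hi
    linarith

/-- If `(1 - δ) F ≤ V ≤ W ≤ (1 + δ) F` eventually, for every `δ`, then `W / V → 1` and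
`V / F → 1`. -/
lemma tendsto_div_of_forall_bounds {ι : Type*} {l : Filter ι} {F : ι → ℝ} {V W : ι → ℝ≥0∞}
    (hF : ∀ᶠ i in l, 0 < F i) (hVW : ∀ᶠ i in l, V i ≤ W i)
    (hlow : ∀ δ : ℝ, 0 < δ → δ < 1 → ∀ᶠ i in l, ENNReal.ofReal ((1 - δ) * F i) ≤ V i)
    (hup : ∀ δ : ℝ, 0 < δ → ∀ᶠ i in l, W i ≤ ENNReal.ofReal ((1 + δ) * F i)) :
    Tendsto (fun i => W i / V i) l (𝓝 1) ∧
      Tendsto (fun i => V i / ENNReal.ofReal (F i)) l (𝓝 1) := by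
  have hWfin : ∀ᶠ i in l, W i ≠ ∞ := (hup 1 one_pos).mono fun i hi =>
    ne_top_of_le_ne_top ENNReal.ofReal_ne_top hi
  have hVlow : ∀ δ : ℝ, 0 < δ → δ < 1 → ∀ᶠ i in l, 1 - δ ≤ (V i).toReal / F i := by
    intro δ h0 h1
    filter_upwards [hF, hVW, hlow δ h0 h1, hWfin] with i hF hVW hlow hfin
    rw [le_div_iff₀ hF]
    exact (ENNReal.ofReal_le_iff_le_toReal (ne_top_of_le_ne_top hfin hVW)).1 hlow
  have hWup : ∀ δ : ℝ, 0 < δ → ∀ᶠ i in l, (W i).toReal / F i ≤ 1 + δ := by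
    intro δ h0
    filter_upwards [hF, hup δ h0] with i hF hup
    rw [div_le_iff₀ hF]
    exact ENNReal.toReal_le_of_le_ofReal (by positivity) hup
  have hVWr : ∀ᶠ i in l, (V i).toReal / F i ≤ (W i).toReal / F i := by
    filter_upwards [hF, hVW, hWfin] with i hF hVW hfin
    exact div_le_div_of_nonneg_right (ENNReal.toReal_mono hfin hVW) hF.le
  have hV : Tendsto (fun i => (V i).toReal / F i) l (𝓝 1) :=
    tendsto_one_of_forall_bounds hVlow fun δ h0 => by
      filter_upwards [hVWr, hWup δ h0] with i h1 h2 using h1.trans h2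
  have hW : Tendsto (fun i => (W i).toReal / F i) l (𝓝 1) :=
    tendsto_one_of_forall_bounds (fun δ h0 h1 => by
      filter_upwards [hVWr, hVlow δ h0 h1] with i h2 h3 using h3.trans h2) hWup
  have hVpos : ∀ᶠ i in l, 0 < (V i).toReal := by
    filter_upwards [hF, hVlow (1 / 2) (by norm_num) (by norm_num)] with i hF h
    rw [le_div_iff₀ hF] at h
    linarith
  constructor
  · have h1 := ENNReal.tendsto_ofReal (hW.div hV one_ne_zero)
    rw [div_one, ENNReal.ofReal_one] at h1
    refine h1.congr' ?_
    filter_upwards [hF, hVW, hWfin, hVpos] with i hF hVW hfin hVpos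
    rw [Pi.div_apply, div_div_div_cancel_right₀ hF.ne', ENNReal.ofReal_div_of_pos hVpos,
      ENNReal.ofReal_toReal hfin, ENNReal.ofReal_toReal (ne_top_of_le_ne_top hfin hVW)]
  · have h1 := ENNReal.tendsto_ofReal hV
    rw [ENNReal.ofReal_one] at h1
    refine h1.congr' ?_
    filter_upwards [hF, hVW, hWfin] with i hF hVW hfin
    rw [ENNReal.ofReal_div_of_pos hF, ENNReal.ofReal_toReal (ne_top_of_le_ne_top hfin hVW)]

end SeqMultTest

theorem mainTheorem1 {K : ℕ} {S : Fin K → Type*} [∀ k, MeasurableSpace (S k)]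
    (M : ∀ k, SeqMultTest.Stream (S k))
    (hKL : ∀ k, (M k).KLPosFinite) (hsecond : ∀ k, (M k).SecondMoments)
    (ℓ u : ℕ) (hℓu : ℓ < u) (huK : u ≤ K) :
    (∀ α ∈ Set.Ioo (0 : ℝ) 1, ∀ β ∈ Set.Ioo (0 : ℝ) 1,
      (SeqMultTest.T_GI M ℓ u α β, SeqMultTest.d_GI M ℓ u α β) ∈
        SeqMultTest.Δ M (SeqMultTest.sizeClass K ℓ u) α β) ∧
    ∀ A ∈ SeqMultTest.sizeClass K ℓ u,
      SeqMultTest.AsympEq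
        (fun α β => SeqMultTest.expectedTime M A (SeqMultTest.T_GI M ℓ u α β))
        (fun α β => SeqMultTest.optimalTime M (SeqMultTest.sizeClass K ℓ u) A α β) ∧
      SeqMultTest.AsympEq
        (fun α β => SeqMultTest.optimalTime M (SeqMultTest.sizeClass K ℓ u) A α β)
        (fun α β => SeqMultTest.firstOrder M ℓ u A α β) := by
  open SeqMultTest in
  refine ⟨fun α hα β hβ => gapIntersection_mem_Δ hKL hℓu huK hα hβ, fun A hA => ?_⟩
  set F : ℝ × ℝ → ℝ := fun q => (firstOrder M ℓ u A q.1 q.2).toReal with hFdef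
  have hF : ∀ q : ℝ × ℝ, firstOrder M ℓ u A q.1 q.2 = ENNReal.ofReal (F q) := fun q =>
    (ENNReal.ofReal_toReal (firstOrder_ne_top hKL ℓ u A q.1 q.2)).symm
  have hFtop : Tendsto F (𝓝[>] (0 : ℝ) ×ˢ 𝓝[>] (0 : ℝ)) atTop := tendsto_firstOrder hKL hℓu huK hA
  have h := tendsto_div_of_forall_bounds (F := F)
    (V := fun q => optimalTime M (sizeClass K ℓ u) A q.1 q.2)
    (W := fun q => expectedTime M A (T_GI M ℓ u q.1 q.2)) (hFtop.eventually_gt_atTop 0) ?_ ?_ ?_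
  · unfold AsympEq
    simp_rw [hF]
    exact h
  · filter_upwards [eventually_mem_Ioo one_pos] with q hq
    exact iInf₂_le (T_GI M ℓ u q.1 q.2, d_GI M ℓ u q.1 q.2)
      (gapIntersection_mem_Δ hKL hℓu huK hq.1 hq.2)
  · intro δ h0 h1
    filter_upwards [eventually_firstOrder_le_optimalTime hKL hℓu huK hA
      (δ := δ / 4) (by linarith) (by linarith)] with q hq
    rw [hF, ← ENNReal.ofReal_mul (by linarith)] at hq
    rwa [mul_div_cancel₀ δ four_ne_zero] at hq
  · intro δ h0
    obtain ⟨C, hC⟩ := exists_expectedTime_T_GI_le hKL hℓu huK hA (r := 1 / (1 + δ / 2))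
      (by positivity) (by rw [div_lt_one (by positivity)]; linarith)
    -- the additive constant is absorbed by `F → ∞`
    filter_upwards [eventually_mem_Ioo one_pos, hFtop.eventually_ge_atTop (2 / δ * C)] with q hq hFq
    refine (hC q.1 hq.1 q.2 hq.2).trans (ENNReal.ofReal_le_ofReal ?_)
    have h2 : C ≤ δ / 2 * F q := by
      have := mul_le_mul_of_nonneg_left hFq (by positivity : 0 ≤ δ / 2)
      rwa [← mul_assoc, show δ / 2 * (2 / δ) = 1 by field_simp, one_mul] at this
    change F q / (1 / (1 + δ / 2)) + C ≤ (1 + δ) * F q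
    rw [div_div_eq_mul_div, div_one]
    linarith
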